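/- Let $m,\nu\ge 0$ and $s>\nu$ be integers, $\Omega\subseteq\mathbb R^{2m}$ open, $H:\Omega\to\mathbb R$ and $L:\Omega\to\mathbb R^{\nu}$ of class $C^\infty$, $J=\begin{pmatrix}0&I_m\\-I_m&0\end{pmatrix}$, and suppose that $L$ consists of invariants of the Hamiltonian system $y'=J\nabla H(y)$, i.e. $\nabla L(y)^TJ\nabla H(y)=0$ for all $y\in\Omega$ ($\nabla L(y)^T$ is the Jacobian matrix of $L$). Let $y_0\in\Omega$, and let $y:[0,T]\to\Omega$, $T>0$, be the solution with $y(0)=y_0$. Let $P_j$, $j\ge 0$, be the Legendre polynomials, shifted and scaled to be orthonormal on $[0,1]$. For $h>0$ and $\sigma:[0,h]\to\Omega$ put $$\phi_j(\sigma)=\int_0^1P_j(\tau)\nabla L(\sigma(\tau h))\,d\tau\in\mathbb R^{2m\times\nu},\qquad \bar\gamma_j(\sigma)=\int_0^1P_j(\tau)J\nabla H(\sigma(\tau h))\,d\tau\in\mathbb R^{2m},$$ $$\Gamma(\sigma)=\Big[h^{2(\nu-1)}\phi_{s-\nu}(\sigma)^T\bar\gamma_{s-\nu}(\sigma),\ \dots,\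 h^{0}\phi_{s-1}(\sigma)^T\bar\gamma_{s-1}(\sigma)\Big]\in\mathbb R^{\nu\times\nu},\qquad b(\sigma)=\sum_{j=0}^{s-1}\phi_j(\sigma)^T\bar\gamma_j(\sigma)\in\mathbb R^\nu .$$ Say that a polynomial $\sigma$ of degree at most $s$ with values in $\mathbb R^{2m}$, together with $\alpha=(\alpha_{s-\nu},\dots,\alpha_{s-1})^T\in\mathbb R^\nu$, is given by the method with step-size $h$ if $\sigma([0,h])\subseteq\Omega$ and $$\sigma(0)=y_0,\qquad \sigma'(ch)=\sum_{j=0}^{s-1}P_j(c)\,\eta_j\,\bar\gamma_j(\sigma)\quad(c\in[0,1]),\qquad \Gamma(\sigma)\,\alpha=b(\sigma),$$ where $\eta_j=1$ for $0\le j\le s-\nu-1$ and $\eta_j=1-h^{2(s-1-j)}\alpha_j$ for $s-\nu\le j\le s-1$. (If $\Gamma(\sigma)$ is nonsingular, then $\alpha=\Gamma(\sigma)^{-1}b(\sigma)$.) Then: 1. For every $h>0$ and every $(\sigma,\alpha)$ given by the method with step-size $h$, all the invariants are conserved at $t=h$: $H(\sigma(h))=H(y_0)$ and $L(\sigma(h))=L(y_0)$.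 (In particular this holds when $\Gamma(\sigma)$ is nonsingular.) 2. For all sufficiently small $h>0$, let $(\sigma,\alpha)=(\sigma_h,\alpha_h)$ be given by the method with step-size $h$, such that the Taylor coefficients of $\sigma_h$ at $0$ are bounded as $h\to0^+$ (i.e. $\sigma_h^{(k)}(0)=O(1)$ for $0\le k\le s$), and such that $\Gamma(\sigma_h)$ is nonsingular at its natural scale $h^{2s-2}$, uniformly in $h$: there is $c>0$ with $\big|\det\big(h^{-(2s-2)}\Gamma(\sigma_h)\big)\big|\ge c$ for all sufficiently small $h>0$. Then $$\sigma_h(h)-y(h)=O(h^{2s+1})\qquad(h\to0^+).$$ -/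

import Mathlib

open scoped Matrix ContDiff Topology

noncomputable section

namespace ELIM

/-- The phase space `ℝ^{2m}` with its Euclidean structure; a point is `y = (q, p)`,
`q` being the `inl` coordinates and `p` the `inr` coordinates. -/
abbrev Phase (m : ℕ) : Type := EuclideanSpace ℝ (Fin m ⊕ Fin m)

/-- The matrix `J = [[0, I], [-I, 0]]`. -/
def symJ (m : ℕ) : Matrix (Fin m ⊕ Fin m) (Fin m ⊕ Fin m) ℝ :=
  Matrix.fromBlocks 0 1 (-1) 0

/-- The Hamiltonian vector field `J ∇H(y)`. -/
def hamField {m : ℕ} (H : Phase m → ℝ) (y : Phase m) : Phase m :=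
  WithLp.toLp 2 (symJ m *ᵥ (gradient H y).ofLp)

/-- `∇L(y)`, the `2m × ν` matrix whose `k`-th column is the gradient of the `k`-th component
of `L`; its transpose is the Jacobian matrix of `L`. -/
def gradMatrix {m ν : ℕ} (L : Phase m → Fin ν → ℝ) (y : Phase m) :
    Matrix (Fin m ⊕ Fin m) (Fin ν) ℝ :=
  Matrix.of fun i k => (gradient (fun z => L z k) y).ofLp i

/-- `P_j`, the `j`-th Legendre polynomial, shifted to `[0,1]` and scaled to be orthonormal in
`L²(0,1)`. Mathlib's `Polynomial.shiftedLegendre j` carries the leading sign `(-1)^j`. -/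
def legendre (j : ℕ) : Polynomial ℝ :=
  Polynomial.C ((-1) ^ j * Real.sqrt (2 * j + 1)) *
    (Polynomial.shiftedLegendre j).map (Int.castRingHom ℝ)

/-- `φ_j(σ) = ∫₀¹ P_j(τ) ∇L(σ(τh)) dτ`, a `2m × ν` matrix. -/
def phi {m ν : ℕ} (L : Phase m → Fin ν → ℝ) (h : ℝ) (σ : ℝ → Phase m) (j : ℕ) :
    Matrix (Fin m ⊕ Fin m) (Fin ν) ℝ :=
  Matrix.of fun i k => ∫ τ in (0 : ℝ)..1, (legendre j).eval τ * gradMatrix L (σ (τ * h)) i k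

/-- `γ̄_j(σ) = ∫₀¹ P_j(τ) J∇H(σ(τh)) dτ`. -/
def gammaBar {m : ℕ} (H : Phase m → ℝ) (h : ℝ) (σ : ℝ → Phase m) (j : ℕ) : Phase m :=
  ∫ τ in (0 : ℝ)..1, (legendre j).eval τ • hamField H (σ (τ * h))

/-- The coefficients `η_j`, `0 ≤ j ≤ s-1`: equal to `1` for `j ≤ s-ν-1`, and to
`1 - h^{2(s-1-j)} α_j` for `s-ν ≤ j ≤ s-1`. Only `α_{s-ν}, …, α_{s-1}` matter. -/
def eta (s ν : ℕ) (h : ℝ) (α : ℕ → ℝ) (j : ℕ) : ℝ :=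
  if j < s - ν then 1 else 1 - h ^ (2 * (s - 1 - j)) * α j

/-- `Γ(σ)`, the `ν × ν` matrix with columns `h^{2(s-1-j)} φ_j(σ)ᵀ γ̄_j(σ)`,
`j = s-ν, …, s-1`. -/
def Gam {m ν : ℕ} (s : ℕ) (H : Phase m → ℝ) (L : Phase m → Fin ν → ℝ) (h : ℝ)
    (σ : ℝ → Phase m) : Matrix (Fin ν) (Fin ν) ℝ :=
  Matrix.of fun k i =>
    h ^ (2 * (s - 1 - (s - ν + (i : ℕ)))) *
      ((phi L h σ (s - ν + (i : ℕ)))ᵀ *ᵥ (gammaBar H h σ (s - ν + (i : ℕ))).ofLp) k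

/-- `b(σ) = ∑_{j=0}^{s-1} φ_j(σ)ᵀ γ̄_j(σ)`. -/
def bvec {m ν : ℕ} (s : ℕ) (H : Phase m → ℝ) (L : Phase m → Fin ν → ℝ) (h : ℝ)
    (σ : ℝ → Phase m) : Fin ν → ℝ :=
  ∑ j ∈ Finset.range s, (phi L h σ j)ᵀ *ᵥ (gammaBar H h σ j).ofLp

/-- `σ` is the polynomial approximation on `[0,h]`, started at `y₀`, that is defined by the
method with coefficients `η_j` modified by `α`. Here `Ω` is the domain of `H` and `L`. -/
structure IsApprox {m ν : ℕ} (s : ℕ) (Ω : Set (Phase m)) (H : Phase m → ℝ)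
    (L : Phase m → Fin ν → ℝ) (y₀ : Phase m) (h : ℝ) (σ : ℝ → Phase m) (α : ℕ → ℝ) :
    Prop where
  /-- `σ ∈ Π_s` -/
  poly : ∃ p : ℕ → Phase m, ∀ t, σ t = ∑ i ∈ Finset.range (s + 1), t ^ i • p i
  /-- `σ(0) = y₀` -/
  init : σ 0 = y₀
  /-- `σ` stays in the domain of the problem over the step -/
  mem : ∀ t ∈ Set.Icc 0 h, σ t ∈ Ω
  /-- `σ'(ch) = ∑_{j<s} P_j(c) γ_j(σ)` with `γ_j(σ) = η_j γ̄_j(σ)` -/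
  deriv_eq : ∀ c ∈ Set.Icc (0 : ℝ) 1,
    deriv σ (c * h) =
      ∑ j ∈ Finset.range s, (legendre j).eval c • (eta s ν h α j • gammaBar H h σ j)
  /-- `Γ(σ) (α_{s-ν}, …, α_{s-1})ᵀ = b(σ)` -/
  alpha_eq : Gam s H L h σ *ᵥ (fun i : Fin ν => α (s - ν + (i : ℕ))) = bvec s H L h σ

end ELIM

end

/-! Write `f = J∇H`. Integrating `(g ∘ σ)'` over the step and expanding `σ'` in Legendre polynomials
gives `g(σ(h)) - g(y₀) = h ∑ η_j ⟨(∇g)_j, γ̄_j⟩`, where `(∇g)_j` is the `j`-th Legendre coefficient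
of `∇g` along `σ` (`IsApprox.sub_eq_sum`). For `g = H` every term vanishes, since `γ̄_j = J (∇H)_j`
and `J` is skew. For the components of `L` the sum is `h (b - Γα)`, which the equation for `α` makes
zero.

For the order, smooth functions along `σ_h` are approximated on `[0,h]` by polynomials in `t` with
bounded coefficients, to every order and uniformly in `h` (`PolyApprox`). Hence `j`-th Legendre
coefficients are `O(h^j)`, so the entries of `h^{-(2s-2)} Γ` are bounded. As `∇Lᵀ f = 0` pointwise,
`b` is a truncated Parseval sum of a vanishing product and equals an integral of a product of two
remainders `O(h^s)`; thus `b = O(h^{2s})`. The lower bound on the determinant then yields `α =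
O(h²)` (`alpha_isBigO`).

Consequently `σ'` is the Legendre projection of `f(σ)` minus `∑ P_j D_j` with `D_j = O(h^{2s-j})`.
The residual `r = σ' - f(σ)` is `O(h^s)`, and its moments against polynomials of degree less than
`s` are `O(h^{2s})`. A duality argument finishes the proof: for `e = σ - y` and a polynomial `Z` of
degree less than `s` that nearly solves `Z' = -Z f'(σ)`, `Z(0) = 1`, the integral of `(Ze)'` reduces
to the moment of `r` against `Z`, up to `O(h^{2s+1})` (`StepCurve.end_error_isBigO`). -/

/-! ### Shifted Legendre polynomials: Rodrigues' formula and orthonormality -/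

open Polynomial in
theorem Polynomial.integral_mul_derivative_eq_neg (p q : ℝ[X]) (h0 : q.eval 0 = 0)
    (h1 : q.eval 1 = 0) :
    ∫ x in (0 : ℝ)..1, (p * derivative q).eval x =
      -∫ x in (0 : ℝ)..1, (derivative p * q).eval x := by
  have h := intervalIntegral.integral_mul_deriv_eq_deriv_mul
    (a := (0 : ℝ)) (b := 1) (u := fun x => p.eval x) (v := fun x => q.eval x)
    (u' := fun x => (derivative p).eval x) (v' := fun x => (derivative q).eval x)
    (fun x _ => p.hasDerivAt x) (fun x _ => q.hasDerivAt x)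
    ((derivative p).continuous.intervalIntegrable _ _)
    ((derivative q).continuous.intervalIntegrable _ _)
  simp only [eval_mul]
  rw [h, h0, h1]
  ring

open Polynomial in
theorem Polynomial.integral_mul_iterate_derivative (p q : ℝ[X]) (n : ℕ)
    (h0 : ∀ i < n, (derivative^[i] q).eval 0 = 0) (h1 : ∀ i < n, (derivative^[i] q).eval 1 = 0) :
    ∫ x in (0 : ℝ)..1, (p * derivative^[n] q).eval x =
      (-1) ^ n * ∫ x in (0 : ℝ)..1, (derivative^[n] p * q).eval x := by
  induction n generalizing p with
  | zero => simp
  | succ n ih =>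
    rw [Function.iterate_succ_apply' derivative n q,
      integral_mul_derivative_eq_neg _ _ (h0 n n.lt_succ_self) (h1 n n.lt_succ_self),
      ih _ (fun i hi => h0 i (hi.trans n.lt_succ_self)) (fun i hi => h1 i (hi.trans n.lt_succ_self)),
      ← Function.iterate_succ_apply]
    ring

-- The Beta integral. Integration by parts trades a factor `1 - X` for a factor `X`, hence the
-- induction on `b` with `a` free. The case `a = b = n` normalises `legendre n`.
open Polynomial in
theorem Polynomial.integral_X_pow_mul_one_sub_X_pow (a b : ℕ) :
    ∫ x in (0 : ℝ)..1, ((X : ℝ[X]) ^ a * (1 - X) ^ b).eval x =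
      (a.factorial * b.factorial : ℝ) / (a + b + 1).factorial := by
  induction b generalizing a with
  | zero =>
    simp only [pow_zero, mul_one, eval_pow, eval_X, integral_pow, add_zero, Nat.factorial_zero,
      Nat.cast_one, Nat.factorial_succ, Nat.cast_mul]
    have : (a.factorial : ℝ) ≠ 0 := by positivity
    have : ((a : ℝ) + 1) ≠ 0 := by positivity
    push_cast
    field_simp
    simp
  | succ b ih =>
    have h' := intervalIntegral.integral_mul_deriv_eq_deriv_mul
      (a := (0 : ℝ)) (b := 1) (u := fun x => ((1 - X : ℝ[X]) ^ (b + 1)).eval x)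
      (v := fun x => ((X : ℝ[X]) ^ (a + 1)).eval x)
      (fun x _ => Polynomial.hasDerivAt _ x) (fun x _ => Polynomial.hasDerivAt _ x)
      (Polynomial.continuous _ |>.intervalIntegrable _ _)
      (Polynomial.continuous _ |>.intervalIntegrable _ _)
    have e1 : ∀ x : ℝ, ((1 - X : ℝ[X]) ^ (b + 1)).eval x *
        (derivative ((X : ℝ[X]) ^ (a + 1))).eval x =
        (a + 1) * ((X : ℝ[X]) ^ a * (1 - X) ^ (b + 1)).eval x := by
      intro x; simp; ring
    have e2 : ∀ x : ℝ, (derivative ((1 - X : ℝ[X]) ^ (b + 1))).eval x *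
        ((X : ℝ[X]) ^ (a + 1)).eval x =
        -(b + 1) * ((X : ℝ[X]) ^ (a + 1) * (1 - X) ^ b).eval x := by
      intro x; simp [derivative_pow]; ring
    simp only [e1, e2, intervalIntegral.integral_const_mul, ih] at h'
    have e3 : a + 1 + b + 1 = a + (b + 1) + 1 := by ring
    rw [e3] at h'
    have h2 : ((a : ℝ) + 1) ≠ 0 := by positivity
    apply mul_left_cancel₀ h2
    rw [h']
    simp [Nat.factorial_succ]
    field_simp
    ring

namespace ELIM

open Polynomial

theorem legendre_rodrigues (n : ℕ) :
    legendre n = C ((-1) ^ n * Real.sqrt (2 * n + 1) * (n.factorial : ℝ)⁻¹) *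
      derivative^[n] ((X : ℝ[X]) ^ n * (1 - X) ^ n) := by
  have h := congrArg (Polynomial.map (Int.castRingHom ℝ)) (factorial_mul_shiftedLegendre_eq n)
  rw [← iterate_derivative_map] at h
  simp only [Polynomial.map_mul, Polynomial.map_pow, Polynomial.map_natCast, Polynomial.map_sub,
    Polynomial.map_X, Polynomial.map_one] at h
  rw [← h, legendre, ← C_eq_natCast, ← mul_assoc, ← C_mul, mul_assoc,
    inv_mul_cancel₀ (by positivity), mul_one]

theorem degree_legendre (n : ℕ) : (legendre n).degree = n := by
  rw [legendre, degree_C_mul, degree_map_eq_of_injective (RingHom.injective_int _),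
    degree_shiftedLegendre]
  have : Real.sqrt (2 * n + 1) ≠ 0 := by positivity
  simp [this]

theorem coeff_legendre_self (n : ℕ) :
    (legendre n).coeff n = Real.sqrt (2 * n + 1) * (2 * n).choose n := by
  rw [legendre, coeff_C_mul, coeff_map, coeff_shiftedLegendre, ← two_mul]
  have : ((-1 : ℝ) ^ n) * (-1) ^ n = 1 := by rw [← mul_pow]; simp
  simp
  linear_combination (Real.sqrt (2 * n + 1) * (2 * n).choose n) * this

theorem eval_iterate_derivative_eq_zero (n i : ℕ) (hi : i < n) :
    (derivative^[i] ((X : ℝ[X]) ^ n * (1 - X) ^ n)).eval 0 = 0 ∧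
      (derivative^[i] ((X : ℝ[X]) ^ n * (1 - X) ^ n)).eval 1 = 0 := by
  have hn : n - i ≠ 0 := by lia
  constructor
  · exact eval_eq_zero_of_dvd_of_eval_eq_zero
      (pow_sub_dvd_iterate_derivative_of_pow_dvd i (Dvd.intro _ rfl)) (by simp [hn])
  · exact eval_eq_zero_of_dvd_of_eval_eq_zero
      (pow_sub_dvd_iterate_derivative_of_pow_dvd i (Dvd.intro_left _ rfl)) (by simp [hn])

/-- Rodrigues' formula followed by `n` integrations by parts, whose sign cancels the `(-1)^n` in the
normalisation. Orthogonality to lower degrees and the unit norm both follow from it. -/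
theorem integral_mul_legendre (p : ℝ[X]) (n : ℕ) :
    ∫ x in (0 : ℝ)..1, p.eval x * (legendre n).eval x =
      Real.sqrt (2 * n + 1) * (n.factorial : ℝ)⁻¹ *
        ∫ x in (0 : ℝ)..1, (derivative^[n] p * (X ^ n * (1 - X) ^ n)).eval x := by
  have h := integral_mul_iterate_derivative p ((X : ℝ[X]) ^ n * (1 - X) ^ n) n
    (fun i hi => (eval_iterate_derivative_eq_zero n i hi).1)
    (fun i hi => (eval_iterate_derivative_eq_zero n i hi).2)
  have e : ∀ x : ℝ, p.eval x * (legendre n).eval x =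
      ((-1) ^ n * Real.sqrt (2 * n + 1) * (n.factorial : ℝ)⁻¹) *
        (p * derivative^[n] ((X : ℝ[X]) ^ n * (1 - X) ^ n)).eval x := by
    intro x; rw [legendre_rodrigues]; simp only [eval_mul, eval_C]; ring
  simp only [e, intervalIntegral.integral_const_mul, h]
  have : ((-1 : ℝ) ^ n) * (-1) ^ n = 1 := by rw [← mul_pow]; simp
  linear_combination (Real.sqrt (2 * n + 1) * (n.factorial : ℝ)⁻¹ *
        ∫ x in (0 : ℝ)..1, (derivative^[n] p * (X ^ n * (1 - X) ^ n)).eval x) * this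

theorem integral_mul_legendre_eq_zero (p : ℝ[X]) (n : ℕ) (hp : p.degree < n) :
    ∫ x in (0 : ℝ)..1, p.eval x * (legendre n).eval x = 0 := by
  rw [integral_mul_legendre, iterate_derivative_eq_zero_of_degree_lt hp]
  simp

theorem integral_legendre_sq (n : ℕ) :
    ∫ x in (0 : ℝ)..1, (legendre n).eval x * (legendre n).eval x = 1 := by
  have hd : derivative^[n] (legendre n) = C (n.factorial * (legendre n).coeff n) := by
    have h0 : (derivative^[n] (legendre n)).natDegree = 0 := by
      have := natDegree_iterate_derivative (legendre n) n
      rw [natDegree_eq_of_degree_eq_some (degree_legendre n)] at this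
      simpa using this
    rw [eq_C_of_natDegree_eq_zero h0, coeff_iterate_derivative]
    simp [Nat.descFactorial_self]
  rw [integral_mul_legendre, hd]
  simp only [eval_mul (p := C _), eval_C, intervalIntegral.integral_const_mul,
    integral_X_pow_mul_one_sub_X_pow, coeff_legendre_self]
  have hs : Real.sqrt (2 * n + 1) * Real.sqrt (2 * n + 1) = 2 * n + 1 :=
    Real.mul_self_sqrt (by positivity)
  have hc : ((2 * n).choose n : ℝ) * n.factorial * n.factorial = (2 * n).factorial := by
    have := Nat.choose_mul_factorial_mul_factorial (n := 2 * n) (k := n) (by lia)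
    rw [show 2 * n - n = n by lia] at this
    exact_mod_cast this
  have hf : ((n + n + 1).factorial : ℝ) = (2 * n + 1) * (2 * n).factorial := by
    rw [← two_mul, Nat.factorial_succ]; push_cast; ring
  rw [hf, ← hc]
  have : (n.factorial : ℝ) ≠ 0 := by positivity
  have : ((2 * n).choose n : ℝ) ≠ 0 := by
    exact_mod_cast (Nat.choose_pos (by lia)).ne'
  have : (2 * n + 1 : ℝ) ≠ 0 := by positivity
  field_simp
  linear_combination hs

theorem integral_legendre_mul_legendre (i j : ℕ) :
    ∫ x in (0 : ℝ)..1, (legendre i).eval x * (legendre j).eval x = if i = j then 1 else 0 := by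
  split_ifs with h
  · rw [h, integral_legendre_sq]
  · rcases lt_or_gt_of_ne h with h | h
    · exact integral_mul_legendre_eq_zero _ _ (by rw [degree_legendre]; exact_mod_cast h)
    · simp_rw [mul_comm ((legendre i).eval _)]
      exact integral_mul_legendre_eq_zero _ _ (by rw [degree_legendre]; exact_mod_cast h)

/-- The Legendre coefficient `∫₀¹ P_j(c) • u(c) dc` of a function on `[0,1]`. -/
noncomputable def legendreCoeff {F : Type*} [NormedAddCommGroup F] [NormedSpace ℝ F]
    (u : ℝ → F) (j : ℕ) : F :=
  ∫ c in (0 : ℝ)..1, (legendre j).eval c • u c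

/-- `legendre j` has degree exactly `j`, so the first `s` of them span the polynomials of degree
less than `s`. -/
theorem exists_pow_eq_sum_legendre (s k : ℕ) (hk : k < s) :
    ∃ κ : ℕ → ℝ, ∀ c : ℝ, c ^ k = ∑ j ∈ Finset.range s, κ j * (legendre j).eval c := by
  let S : Polynomial.Sequence ℝ := ⟨legendre, degree_legendre⟩
  have hS : ∀ i, S i = legendre i := fun _ => rfl
  have h := S.span_degreeLT (m := s) fun i _ =>
    (leadingCoeff_ne_zero.mpr (S.ne_zero i)).isUnit
  have hmem : (X ^ k : ℝ[X]) ∈ Submodule.span ℝ (S '' Set.Iio s) := by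
    rw [h, mem_degreeLT, degree_X_pow]; exact_mod_cast hk
  have : S '' Set.Iio s = (S '' (Finset.range s : Set ℕ)) := by simp
  rw [this, Submodule.mem_span_image_finset_iff_exists_fun'] at hmem
  obtain ⟨κ, hκ⟩ := hmem
  refine ⟨κ, fun c => ?_⟩
  have := congrArg (eval c) hκ
  simp only [eval_finsetSum, eval_smul, smul_eq_mul, eval_pow, eval_X, hS] at this
  exact this.symm

theorem pow_eq_sum_integral_mul_legendre (s k : ℕ) (hk : k < s) (c : ℝ) :
    c ^ k = ∑ j ∈ Finset.range s,
      (∫ x in (0 : ℝ)..1, (legendre j).eval x * x ^ k) * (legendre j).eval c := by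
  obtain ⟨κ, hκ⟩ := exists_pow_eq_sum_legendre s k hk
  rw [hκ c]
  refine Finset.sum_congr rfl fun j hj => ?_
  congr 1
  simp only [hκ, Finset.mul_sum]
  rw [intervalIntegral.integral_finsetSum]
  · simp only [mul_left_comm _ (κ _), intervalIntegral.integral_const_mul,
      integral_legendre_mul_legendre]
    simp [Finset.mem_range.mp hj]
  · intro i _
    exact ((legendre j).continuous.mul
      (continuous_const.mul (legendre i).continuous)).intervalIntegrable _ _

theorem integral_legendre_mul_pow_eq_zero (j k : ℕ) (hk : k < j) :
    ∫ x in (0 : ℝ)..1, (legendre j).eval x * x ^ k = 0 := by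
  have := integral_mul_legendre_eq_zero (X ^ k) j (by rw [degree_X_pow]; exact_mod_cast hk)
  simpa [mul_comm] using this

end ELIM

/-! ### Estimates uniform on the step `[0,h]` and approximation by polynomials -/

namespace ELIM

open Filter Asymptotics

/-- The filter on pairs `(h, t)` with `0 ≤ t ≤ h` and `h → 0⁺`: an estimate along it is an
estimate on the step `[0,h]` that is uniform in `h`. -/
def stepFilter : Filter (ℝ × ℝ) :=
  comap Prod.fst (𝓝[>] (0 : ℝ)) ⊓ 𝓟 {x | x.2 ∈ Set.Icc 0 x.1}

theorem eventually_stepFilter {P : ℝ × ℝ → Prop} :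
    (∀ᶠ x in stepFilter, P x) ↔ ∀ᶠ h in 𝓝[>] (0 : ℝ), ∀ t ∈ Set.Icc 0 h, P (h, t) := by
  rw [stepFilter, eventually_inf_principal, eventually_comap]
  refine eventually_congr (Eventually.of_forall fun h => ⟨fun H t ht => H (h, t) rfl ht, ?_⟩)
  rintro H ⟨h', t⟩ rfl ht
  exact H t ht

theorem tendsto_fst_stepFilter : Tendsto Prod.fst stepFilter (𝓝[>] (0 : ℝ)) :=
  tendsto_comap.mono_left inf_le_left

theorem tendsto_step_end : Tendsto (fun h : ℝ => (h, h)) (𝓝[>] (0 : ℝ)) stepFilter := by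
  rw [Filter.tendsto_iff_eventually]
  intro P hP
  filter_upwards [eventually_stepFilter.1 hP, self_mem_nhdsWithin] with h hh h0
  exact hh h ⟨le_of_lt h0, le_rfl⟩

theorem isBigO_snd_fst : (fun x : ℝ × ℝ => x.2) =O[stepFilter] fun x => x.1 := by
  refine IsBigO.of_bound 1 (eventually_stepFilter.2 (Eventually.of_forall fun h t ht => ?_))
  simp only [Real.norm_eq_abs, one_mul]
  rw [abs_of_nonneg ht.1]
  exact ht.2.trans (le_abs_self h)

theorem isBigO_pow_nhdsGT {m n : ℕ} (hmn : m ≤ n) :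
    (fun h : ℝ => h ^ n) =O[𝓝[>] 0] fun h => h ^ m := by
  refine IsBigO.of_bound 1 ?_
  filter_upwards [Ioc_mem_nhdsGT (zero_lt_one' ℝ)] with h hh
  rw [one_mul, norm_pow, norm_pow, Real.norm_of_nonneg hh.1.le]
  exact pow_le_pow_of_le_one hh.1.le hh.2 hmn

theorem isBigO_pow_step {m n : ℕ} (hmn : m ≤ n) :
    (fun x : ℝ × ℝ => x.1 ^ n) =O[stepFilter] fun x => x.1 ^ m :=
  (isBigO_pow_nhdsGT hmn).comp_tendsto tendsto_fst_stepFilter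

section

variable {F : Type*} [NormedAddCommGroup F]

theorem exists_bound_step {u : ℝ × ℝ → F} {n : ℕ} (hu : u =O[stepFilter] fun x => x.1 ^ n) :
    ∃ C, 0 < C ∧ ∀ᶠ h in 𝓝[>] (0 : ℝ), ∀ t ∈ Set.Icc 0 h, ‖u (h, t)‖ ≤ C * h ^ n := by
  obtain ⟨C, hC0, hC⟩ := hu.exists_pos
  refine ⟨C, hC0, ?_⟩
  filter_upwards [eventually_stepFilter.1 hC.bound, self_mem_nhdsWithin] with h hh h0 t ht
  have := hh t ht
  rwa [norm_pow, Real.norm_of_nonneg (le_of_lt h0)] at this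

theorem isBigO_step_of_bound {u : ℝ × ℝ → F} {n : ℕ} (C : ℝ)
    (hu : ∀ᶠ h in 𝓝[>] (0 : ℝ), ∀ t ∈ Set.Icc 0 h, ‖u (h, t)‖ ≤ C * h ^ n) :
    u =O[stepFilter] fun x => x.1 ^ n := by
  refine IsBigO.of_bound C (eventually_stepFilter.2 ?_)
  filter_upwards [hu, self_mem_nhdsWithin] with h hh h0 t ht
  rw [norm_pow, Real.norm_of_nonneg (le_of_lt h0)]
  exact hh t ht

end

section

variable {F G K : Type*} [NormedAddCommGroup F] [NormedSpace ℝ F]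
  [NormedAddCommGroup G] [NormedSpace ℝ G] [NormedAddCommGroup K] [NormedSpace ℝ K]

theorem isBigO_bilinear {X : Type*} {l : Filter X} (B : F →L[ℝ] G →L[ℝ] K) {f : X → F}
    {g : X → G} {φ ψ : X → ℝ} (hf : f =O[l] φ) (hg : g =O[l] ψ) :
    (fun x => B (f x) (g x)) =O[l] fun x => φ x * ψ x := by
  refine (IsBigO.of_bound ‖B‖ (Eventually.of_forall fun x => ?_)).trans
    (hf.norm_left.mul hg.norm_left)
  simpa [mul_assoc] using B.le_opNorm₂ (f x) (g x)

/-- The mean value inequality on the step. -/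
theorem isBigO_step_of_hasDerivWithinAt {u u' : ℝ × ℝ → F} {n : ℕ}
    (hd : ∀ᶠ h in 𝓝[>] (0 : ℝ), ∀ t ∈ Set.Icc 0 h,
      HasDerivWithinAt (fun t => u (h, t)) (u' (h, t)) (Set.Icc 0 h) t)
    (hu : u' =O[stepFilter] fun x => x.1 ^ n) :
    (fun x => u x - u (x.1, 0)) =O[stepFilter] fun x => x.1 ^ (n + 1) := by
  obtain ⟨C, hC0, hC⟩ := exists_bound_step hu
  refine isBigO_step_of_bound C ?_
  filter_upwards [hd, hC, self_mem_nhdsWithin] with h hd hC h0 t ht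
  have := norm_image_sub_le_of_norm_deriv_le_segment' hd
    (fun x hx => hC x (Set.Ico_subset_Icc_self hx)) t ht
  refine this.trans ?_
  rw [pow_succ, ← mul_assoc, sub_zero]
  have : (0 : ℝ) ≤ h := le_of_lt h0
  exact mul_le_mul_of_nonneg_left ht.2 (by positivity)

/-- The polynomial `∑_{k<n} t^k a_k(h)` in `t`, at `x = (h, t)`. -/
def polyFam (n : ℕ) (a : ℕ → ℝ → F) (x : ℝ × ℝ) : F :=
  ∑ k ∈ Finset.range n, x.2 ^ k • a k x.1

/-- On the step `[0,h]` the family `u` agrees up to `O(h^n)` with polynomials in `t` of degree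
less than `n`, the coefficients of which are bounded as `h → 0⁺`. -/
def PolyApprox (n : ℕ) (u : ℝ × ℝ → F) : Prop :=
  ∃ a : ℕ → ℝ → F, (∀ k, a k =O[𝓝[>] 0] fun _ => (1 : ℝ)) ∧
    (fun x => u x - polyFam n a x) =O[stepFilter] fun x => x.1 ^ n

/-- On the step `0 ≤ t ≤ h`, so `t^k` counts as `h^k`. Monomials of degree at least `n` can
therefore be moved into the remainder of a `PolyApprox n`. -/
theorem isBigO_pow_smul_coeff {a : ℝ → F} (ha : a =O[𝓝[>] 0] fun _ => (1 : ℝ)) {k n : ℕ}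
    (hnk : n ≤ k) :
    (fun x : ℝ × ℝ => x.2 ^ k • a x.1) =O[stepFilter] fun x => x.1 ^ n := by
  have h := (isBigO_snd_fst.pow k).smul (ha.comp_tendsto tendsto_fst_stepFilter)
  simp only [smul_eq_mul, Function.comp_def, mul_one] at h
  exact h.trans (isBigO_pow_step hnk)

theorem PolyApprox.of_isBigO {n : ℕ} {u : ℝ × ℝ → F} (hu : u =O[stepFilter] fun x => x.1 ^ n) :
    PolyApprox n u :=
  ⟨fun _ _ => 0, fun _ => isBigO_zero _ _, by simpa [polyFam] using hu⟩

theorem PolyApprox.add {n : ℕ} {u v : ℝ × ℝ → F} (hu : PolyApprox n u) (hv : PolyApprox n v) :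
    PolyApprox n fun x => u x + v x := by
  obtain ⟨a, ha, hu⟩ := hu
  obtain ⟨b, hb, hv⟩ := hv
  refine ⟨fun k h => a k h + b k h, fun k => (ha k).add (hb k), (hu.add hv).congr_left fun x => ?_⟩
  simp only [polyFam, smul_add, Finset.sum_add_distrib]
  abel

theorem PolyApprox.sum {n : ℕ} {ι : Type*} (S : Finset ι) {u : ι → ℝ × ℝ → F}
    (hu : ∀ i ∈ S, PolyApprox n (u i)) : PolyApprox n fun x => ∑ i ∈ S, u i x := by
  classical
  induction S using Finset.induction_on with
  | empty => exact .of_isBigO (by simpa using isBigO_zero (E' := F) (fun x : ℝ × ℝ => x.1 ^ n) stepFilter)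
  | insert i S hi ih =>
    simp only [Finset.sum_insert hi]
    exact (hu i (Finset.mem_insert_self _ _)).add
      (ih fun j hj => hu j (Finset.mem_insert_of_mem hj))

theorem PolyApprox.pow_smul (n k : ℕ) {a : ℝ → F} (ha : a =O[𝓝[>] 0] fun _ => (1 : ℝ)) :
    PolyApprox n fun x => x.2 ^ k • a x.1 := by
  by_cases hk : k < n
  · refine ⟨fun j h => if j = k then a h else 0, fun j => ?_, ?_⟩
    · by_cases hj : j = k
      · simpa [hj] using ha
      · simpa [hj] using isBigO_zero (E' := F) (fun _ : ℝ => (1 : ℝ)) (𝓝[>] (0 : ℝ))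
    · simp only [polyFam, smul_ite, smul_zero]
      simpa [hk] using isBigO_zero (E' := F) (fun x : ℝ × ℝ => x.1 ^ n) stepFilter
  · exact .of_isBigO (isBigO_pow_smul_coeff ha (not_lt.mp hk))

theorem polyApprox_polyFam (n m : ℕ) {a : ℕ → ℝ → F}
    (ha : ∀ k, a k =O[𝓝[>] 0] fun _ => (1 : ℝ)) : PolyApprox n (polyFam m a) :=
  .sum _ fun k _ => .pow_smul n k (ha k)

theorem PolyApprox.congr' {n : ℕ} {u v : ℝ × ℝ → F} (hu : PolyApprox n u)
    (h : u =ᶠ[stepFilter] v) : PolyApprox n v := by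
  obtain ⟨a, ha, hu⟩ := hu
  refine ⟨a, ha, hu.congr' ?_ EventuallyEq.rfl⟩
  filter_upwards [h] with x hx
  rw [hx]

theorem PolyApprox.of_sub {n : ℕ} {u v : ℝ × ℝ → F} (hu : PolyApprox n u)
    (h : (fun x => v x - u x) =O[stepFilter] fun x => x.1 ^ n) : PolyApprox n v :=
  (hu.add (.of_isBigO h)).congr' (Eventually.of_forall fun x => by simp)

theorem PolyApprox.mono {m n : ℕ} (hmn : m ≤ n) {u : ℝ × ℝ → F} (hu : PolyApprox n u) :
    PolyApprox m u := by
  obtain ⟨a, ha, hu⟩ := hu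
  exact (polyApprox_polyFam m n ha).of_sub (hu.trans (isBigO_pow_step hmn))

/-- At order `0` the polynomial is empty and the remainder `O(h^0)` is the whole family. -/
theorem PolyApprox.isBigO_one {n : ℕ} {u : ℝ × ℝ → F} (hu : PolyApprox n u) :
    u =O[stepFilter] fun _ => (1 : ℝ) := by
  obtain ⟨a, ha, hu⟩ := hu.mono (Nat.zero_le n)
  simpa [polyFam] using hu

theorem PolyApprox.bilinear {n : ℕ} {u : ℝ × ℝ → F} {v : ℝ × ℝ → G} (B : F →L[ℝ] G →L[ℝ] K)
    (hu : PolyApprox n u) (hv : PolyApprox n v) : PolyApprox n fun x => B (u x) (v x) := by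
  have hu1 := hu.isBigO_one
  obtain ⟨a, ha, hua⟩ := hu
  obtain ⟨b, hb, hvb⟩ := hv
  have hb1 := (polyApprox_polyFam n n hb).isBigO_one
  -- With `p`, `q` the two approximating polynomials, `B(p, q)` may have degree above `n - 1`, but
  -- `PolyApprox.pow_smul` absorbs the excess monomials. The rest is `B(u, v) - B(p, q) = B(u - p,
  -- q) + B(u, v - q)`.
  have hp : PolyApprox n fun x => B (polyFam n a x) (polyFam n b x) := by
    have : ∀ x : ℝ × ℝ, B (polyFam n a x) (polyFam n b x) =
        ∑ k ∈ Finset.range n, ∑ l ∈ Finset.range n, x.2 ^ (k + l) • B (a k x.1) (b l x.1) := by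
      intro x
      simp only [polyFam, map_sum, sum_apply, map_smul,
        smul_apply, pow_add, mul_smul, Finset.smul_sum]
      rw [Finset.sum_comm]
      exact Finset.sum_congr rfl fun k _ => Finset.sum_congr rfl fun l _ => smul_comm _ _ _
    simp only [this]
    refine .sum _ fun k _ => .sum _ fun l _ => .pow_smul n (k + l) (a := fun h => B (a k h) (b l h)) ?_
    simpa using isBigO_bilinear B (ha k) (hb l)
  refine hp.of_sub ?_
  have h1 := (isBigO_bilinear B hua hb1).add ((isBigO_bilinear B hu1 hvb).congr_right fun x => mul_comm _ _)
  simp only [mul_one] at h1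
  refine h1.congr_left fun x => ?_
  simp only [map_sub, sub_apply]
  abel

theorem hasDerivAt_polyFam_primitive (n : ℕ) (a : ℕ → ℝ → F) (h t : ℝ) :
    HasDerivAt (fun t => ∑ k ∈ Finset.range n, t ^ (k + 1) • ((k + 1 : ℝ)⁻¹ • a k h))
      (polyFam n a (h, t)) t := by
  refine HasDerivAt.fun_sum fun k _ => ?_
  have := ((hasDerivAt_pow (k + 1) t).smul_const ((k + 1 : ℝ)⁻¹ • a k h))
  convert this using 1
  have : (k + 1 : ℝ) ≠ 0 := by positivity
  rw [smul_smul]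
  congr 1
  push_cast
  field_simp

/-- A primitive of a `PolyApprox` family is `PolyApprox` of one order more. -/
theorem PolyApprox.of_hasDerivWithinAt {u u' : ℝ × ℝ → F} {n : ℕ}
    (hd : ∀ᶠ h in 𝓝[>] (0 : ℝ), ∀ t ∈ Set.Icc 0 h,
      HasDerivWithinAt (fun t => u (h, t)) (u' (h, t)) (Set.Icc 0 h) t)
    (h0 : (fun h => u (h, 0)) =O[𝓝[>] 0] fun _ => (1 : ℝ))
    (hu : PolyApprox n u') : PolyApprox (n + 1) u := by
  obtain ⟨a, ha, hua⟩ := hu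
  have hc : ∀ k : ℕ, (fun h => (k + 1 : ℝ)⁻¹ • a k h) =O[𝓝[>] 0] fun _ => (1 : ℝ) :=
    fun k => (ha k).const_smul_left _
  let q : ℝ × ℝ → F := fun x =>
    ∑ k ∈ Finset.range n, x.2 ^ (k + 1) • ((k + 1 : ℝ)⁻¹ • a k x.1)
  have hq : PolyApprox (n + 1) fun x => q x + u (x.1, 0) :=
    (PolyApprox.sum (Finset.range n) fun k _ => .pow_smul (n + 1) (k + 1) (hc k)).add
      ((PolyApprox.pow_smul (n + 1) 0 h0).congr' (v := fun x => u (x.1, 0))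
        (Eventually.of_forall fun x => by simp))
  refine hq.of_sub ?_
  -- The mean value inequality applied to `u - q` gains one power of `h`; the initial value `u(h,
  -- 0)` serves as constant term.
  have := isBigO_step_of_hasDerivWithinAt (u := fun x => u x - q x)
    (u' := fun x => u' x - polyFam n a x) (n := n) ?_ hua
  · refine this.congr_left fun x => ?_
    simp [q]
    abel
  · filter_upwards [hd] with h hd t ht
    exact (hd t ht).sub (hasDerivAt_polyFam_primitive n a h t).hasDerivWithinAt

end

/-- A smooth function of a curve with bounded Taylor coefficients is approximated by polynomials
to every order. -/
theorem PolyApprox.comp_contDiffOn {E : Type} [NormedAddCommGroup E] [NormedSpace ℝ E]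
    {Ω : Set E} (hΩ : IsOpen Ω) {y₀ : E} (hy₀ : y₀ ∈ Ω) {σ : ℝ → ℝ → E} {σ' : ℝ × ℝ → E}
    (hd : ∀ᶠ h in 𝓝[>] (0 : ℝ), ∀ t ∈ Set.Icc 0 h, HasDerivAt (σ h) (σ' (h, t)) t)
    (hσ0 : ∀ᶠ h in 𝓝[>] (0 : ℝ), σ h 0 = y₀)
    (hσΩ : ∀ᶠ h in 𝓝[>] (0 : ℝ), ∀ t ∈ Set.Icc 0 h, σ h t ∈ Ω)
    (hσ' : ∀ n, PolyApprox n σ') (hσt : Tendsto (fun x : ℝ × ℝ => σ x.1 x.2) stepFilter (𝓝 y₀))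
    (n : ℕ) {F : Type} [NormedAddCommGroup F] [NormedSpace ℝ F] {g : E → F}
    (hg : ContDiffOn ℝ ∞ g Ω) : PolyApprox n fun x => g (σ x.1 x.2) := by
  -- `(g ∘ σ)' = g'(σ) σ'` is bilinear in `g'(σ)`, known to order `n` by induction, and `σ'`; taking
  -- the primitive gains one order. `F` must vary because `g'` is operator-valued.
  induction n generalizing F with
  | zero =>
    refine .of_isBigO ?_
    have hc : ContinuousAt g y₀ := hg.continuousOn.continuousAt (hΩ.mem_nhds hy₀)
    simpa using (hc.tendsto.comp hσt).isBigO_one ℝ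
  | succ n ih =>
    have hg' : ContDiffOn ℝ ∞ (fderiv ℝ g) Ω := hg.fderiv_of_isOpen hΩ (by simp)
    have h1 := (ih hg').bilinear (ContinuousLinearMap.apply ℝ F).flip (hσ' n)
    refine PolyApprox.of_hasDerivWithinAt ?_ ?_ h1
    · filter_upwards [hd, hσΩ] with h hd hΩ' t ht
      have hgt : HasFDerivAt g (fderiv ℝ g (σ h t)) (σ h t) :=
        ((hg.differentiableOn (by simp)).differentiableAt
          (hΩ.mem_nhds (hΩ' t ht))).hasFDerivAt
      exact (hgt.comp_hasDerivAt t (hd t ht)).hasDerivWithinAt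
    · refine (isBigO_const_const (g y₀) one_ne_zero _).congr' ?_ EventuallyEq.rfl
      filter_upwards [hσ0] with h hh
      rw [hh]

end ELIM

/-! ### Legendre coefficients and projections on the step -/

namespace ELIM

open Filter Asymptotics

section

variable {F G K : Type*} [NormedAddCommGroup F] [NormedSpace ℝ F]
  [NormedAddCommGroup G] [NormedSpace ℝ G] [NormedAddCommGroup K] [NormedSpace ℝ K]

theorem exists_legendre_bound (j : ℕ) :
    ∃ M, 0 ≤ M ∧ ∀ c ∈ Set.Icc (0 : ℝ) 1, ‖(legendre j).eval c‖ ≤ M := by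
  obtain ⟨M, hM⟩ := isCompact_Icc.exists_bound_of_continuousOn
    (legendre j).continuous.continuousOn (s := Set.Icc (0 : ℝ) 1)
  exact ⟨M, (norm_nonneg _).trans (hM 0 (by simp)), hM⟩

theorem intervalIntegrable_legendre_smul {u : ℝ → F} (hu : ContinuousOn u (Set.Icc 0 1)) (j : ℕ) :
    IntervalIntegrable (fun c => (legendre j).eval c • u c) MeasureTheory.volume 0 1 := by
  apply ContinuousOn.intervalIntegrable
  rw [Set.uIcc_of_le zero_le_one]
  exact (legendre j).continuous.continuousOn.smul hu

theorem norm_legendreCoeff_le {j : ℕ} {M C : ℝ} (hM0 : 0 ≤ M)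
    (hM : ∀ c ∈ Set.Icc (0 : ℝ) 1, ‖(legendre j).eval c‖ ≤ M) {u : ℝ → F}
    (hu : ∀ c ∈ Set.Icc (0 : ℝ) 1, ‖u c‖ ≤ C) : ‖legendreCoeff u j‖ ≤ M * C := by
  have := intervalIntegral.norm_integral_le_of_norm_le_const (a := (0 : ℝ)) (b := 1)
    (f := fun c => (legendre j).eval c • u c) (C := M * C) fun c hc => by
      rw [Set.uIoc_of_le zero_le_one] at hc
      have hc' := Set.Ioc_subset_Icc_self hc
      rw [norm_smul]
      exact mul_le_mul (hM c hc') (hu c hc') (norm_nonneg _) hM0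
  simpa [legendreCoeff] using this

theorem legendreCoeff_sub {u v : ℝ → F} (hu : ContinuousOn u (Set.Icc 0 1))
    (hv : ContinuousOn v (Set.Icc 0 1)) (j : ℕ) :
    legendreCoeff (fun c => u c - v c) j = legendreCoeff u j - legendreCoeff v j := by
  simp only [legendreCoeff, smul_sub]
  exact intervalIntegral.integral_sub (intervalIntegrable_legendre_smul hu j)
    (intervalIntegrable_legendre_smul hv j)

theorem legendreCoeff_clm [CompleteSpace F] [CompleteSpace G] {u : ℝ → F}
    (hu : ContinuousOn u (Set.Icc 0 1)) (B : F →L[ℝ] G) (j : ℕ) :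
    legendreCoeff (fun c => B (u c)) j = B (legendreCoeff u j) := by
  simp only [legendreCoeff]
  rw [← B.intervalIntegral_comp_comm (intervalIntegrable_legendre_smul hu j)]
  simp

theorem legendreCoeff_poly [CompleteSpace F] (n j : ℕ) (a : ℕ → F) :
    legendreCoeff (fun c => ∑ k ∈ Finset.range n, c ^ k • a k) j =
      ∑ k ∈ Finset.range n, (∫ c in (0 : ℝ)..1, (legendre j).eval c * c ^ k) • a k := by
  simp only [legendreCoeff, Finset.smul_sum, smul_smul]
  rw [intervalIntegral.integral_finsetSum]
  · exact Finset.sum_congr rfl fun k _ => intervalIntegral.integral_smul_const _ _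
  · intro k _
    exact (((legendre j).continuous.mul (continuous_pow k)).smul
      continuous_const).intervalIntegrable _ _

theorem continuous_poly (n : ℕ) (a : ℕ → F) :
    Continuous fun c : ℝ => ∑ k ∈ Finset.range n, c ^ k • a k := by
  fun_prop

/-- The orthogonal projection onto the polynomials of degree less than `s` in `L²(0,1)`. -/
noncomputable def legendreProj (s : ℕ) (u : ℝ → F) (c : ℝ) : F :=
  ∑ j ∈ Finset.range s, (legendre j).eval c • legendreCoeff u j

theorem continuous_legendreProj (s : ℕ) (u : ℝ → F) : Continuous (legendreProj s u) :=
  continuous_finsetSum _ fun j _ => (legendre j).continuous.smul continuous_const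

theorem legendreProj_poly [CompleteSpace F] (s : ℕ) (a : ℕ → F) (c : ℝ) :
    legendreProj s (fun c => ∑ k ∈ Finset.range s, c ^ k • a k) c =
      ∑ k ∈ Finset.range s, c ^ k • a k := by
  simp only [legendreProj, legendreCoeff_poly, Finset.smul_sum]
  rw [Finset.sum_comm]
  refine Finset.sum_congr rfl fun k hk => ?_
  rw [pow_eq_sum_integral_mul_legendre s k (Finset.mem_range.mp hk) c, Finset.sum_smul]
  exact Finset.sum_congr rfl fun j _ => by rw [smul_smul, mul_comm]

/-- Lebesgue's inequality: the projection `P` fixes a polynomial `p` of degree less than `s`, so `Pu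
- u = P(u - p) - (u - p)`, and `P` is bounded in the sup norm. `M` depends on `s` only, which makes
the bound uniform in the step-size. -/
theorem exists_norm_legendreProj_sub_le (s : ℕ) : ∃ M, 0 ≤ M ∧
    ∀ {F : Type} [NormedAddCommGroup F] [NormedSpace ℝ F] [CompleteSpace F] (u : ℝ → F)
      (a : ℕ → F) (C : ℝ), ContinuousOn u (Set.Icc 0 1) →
      (∀ c ∈ Set.Icc (0 : ℝ) 1, ‖u c - ∑ k ∈ Finset.range s, c ^ k • a k‖ ≤ C) →
      ∀ c ∈ Set.Icc (0 : ℝ) 1, ‖legendreProj s u c - u c‖ ≤ M * C := by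
  choose M hM0 hM using exists_legendre_bound
  refine ⟨∑ j ∈ Finset.range s, M j * M j + 1,
    add_nonneg (Finset.sum_nonneg fun j _ => mul_nonneg (hM0 j) (hM0 j)) zero_le_one, ?_⟩
  intro F _ _ _ u a C hu hC c hc
  set p : ℝ → F := fun c => ∑ k ∈ Finset.range s, c ^ k • a k with hp
  have hpc : Continuous p := continuous_poly s a
  have e : legendreProj s u c - u c = legendreProj s (fun c => u c - p c) c - (u c - p c) := by
    have h1 : legendreProj s (fun c => u c - p c) c = legendreProj s u c - p c := by
      rw [show p c = legendreProj s p c from (legendreProj_poly s a c).symm]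
      simp only [legendreProj, legendreCoeff_sub hu hpc.continuousOn, smul_sub,
        Finset.sum_sub_distrib]
    rw [h1]; abel
  rw [e, add_mul, one_mul, Finset.sum_mul]
  refine (norm_sub_le _ _).trans (add_le_add ((norm_sum_le _ _).trans ?_) (hC c hc))
  refine Finset.sum_le_sum fun j _ => ?_
  rw [norm_smul, mul_assoc]
  exact mul_le_mul (hM j c hc) (norm_legendreCoeff_le (hM0 j) (hM j) hC) (norm_nonneg _) (hM0 j)

theorem legendreCoeff_legendreProj_sub [CompleteSpace F] (s j : ℕ) (hj : j < s) {u : ℝ → F}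
    (hu : ContinuousOn u (Set.Icc 0 1)) :
    legendreCoeff (fun c => legendreProj s u c - u c) j = 0 := by
  rw [legendreCoeff_sub (continuous_legendreProj s u).continuousOn hu, sub_eq_zero]
  conv_lhs => simp only [legendreCoeff, legendreProj, Finset.smul_sum, smul_smul]
  rw [intervalIntegral.integral_finsetSum]
  · simp only [intervalIntegral.integral_smul_const, integral_legendre_mul_legendre]
    simp [hj, legendreCoeff]
  · intro k _
    exact (((legendre j).continuous.mul (legendre k).continuous).smul
      continuous_const).intervalIntegrable _ _

theorem integral_pow_smul_legendreProj_sub [CompleteSpace F] (s k : ℕ) (hk : k < s) {u : ℝ → F}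
    (hu : ContinuousOn u (Set.Icc 0 1)) :
    ∫ c in (0 : ℝ)..1, c ^ k • (legendreProj s u c - u c) = 0 := by
  obtain ⟨κ, hκ⟩ := exists_pow_eq_sum_legendre s k hk
  have hw : ContinuousOn (fun c => legendreProj s u c - u c) (Set.Icc 0 1) :=
    (continuous_legendreProj s u).continuousOn.sub hu
  simp only [hκ, Finset.sum_smul, mul_smul]
  rw [intervalIntegral.integral_finsetSum]
  · refine Finset.sum_eq_zero fun j hj => ?_
    rw [intervalIntegral.integral_smul]
    have := legendreCoeff_legendreProj_sub s j (Finset.mem_range.mp hj) hu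
    rw [legendreCoeff] at this
    rw [this, smul_zero]
  · intro j _
    exact (intervalIntegrable_legendre_smul hw j).smul (κ j)

/-- The projection error is orthogonal to each `c^k`, `k < s`, and the coefficients `a k` come out
of the integral by bilinearity. Used both for the size of `b` and for the moments of the residual.
-/
theorem integral_poly_legendreProj_sub [CompleteSpace G] [CompleteSpace K]
    (B : F →L[ℝ] G →L[ℝ] K) (s : ℕ) (a : ℕ → F) {u : ℝ → G}
    (hu : ContinuousOn u (Set.Icc 0 1)) :
    ∫ c in (0 : ℝ)..1,
      B (∑ k ∈ Finset.range s, c ^ k • a k) (legendreProj s u c - u c) = 0 := by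
  have hw : ContinuousOn (fun c => legendreProj s u c - u c) (Set.uIcc 0 1) := by
    rw [Set.uIcc_of_le zero_le_one]
    exact (continuous_legendreProj s u).continuousOn.sub hu
  have hi : ∀ k : ℕ, IntervalIntegrable (fun c : ℝ => c ^ k • (legendreProj s u c - u c))
      MeasureTheory.volume 0 1 := fun k =>
    ((continuous_pow k).continuousOn.smul hw).intervalIntegrable
  have e : ∀ c : ℝ, B (∑ k ∈ Finset.range s, c ^ k • a k) (legendreProj s u c - u c) =
      ∑ k ∈ Finset.range s, B (a k) (c ^ k • (legendreProj s u c - u c)) := by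
    intro c
    simp
  simp only [e]
  rw [intervalIntegral.integral_finsetSum]
  · refine Finset.sum_eq_zero fun k hk => ?_
    rw [(B (a k)).intervalIntegral_comp_comm (hi k),
      integral_pow_smul_legendreProj_sub s k (Finset.mem_range.mp hk) hu, map_zero]
  · intro k _
    exact (((B (a k)).continuous.comp_continuousOn
      ((continuous_pow k).continuousOn.smul hw))).intervalIntegrable

theorem polyFam_mul (n : ℕ) (a : ℕ → ℝ → F) (h c : ℝ) :
    polyFam n a (h, c * h) = ∑ k ∈ Finset.range n, c ^ k • (h ^ k • a k h) := by
  simp only [polyFam, mul_pow, mul_smul]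

theorem mul_mem_Icc_of_mem {h c : ℝ} (h0 : 0 < h) (hc : c ∈ Set.Icc (0 : ℝ) 1) :
    c * h ∈ Set.Icc 0 h :=
  ⟨mul_nonneg hc.1 h0.le, mul_le_of_le_one_left h0.le hc.2⟩

theorem continuousOn_comp_mul {X : Type*} [TopologicalSpace X] {h : ℝ} (h0 : 0 < h)
    {u : ℝ → X}
    (hu : ContinuousOn u (Set.Icc 0 h)) : ContinuousOn (fun c => u (c * h)) (Set.Icc 0 1) :=
  hu.comp (by fun_prop) fun _ hc => mul_mem_Icc_of_mem h0 hc

/-- `P_j` annihilates the approximating polynomial of degree less than `j`, so only the `O(h^j)`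
remainder contributes. -/
theorem legendreCoeff_isBigO [CompleteSpace F] {j : ℕ} {u : ℝ × ℝ → F} (hu : PolyApprox j u)
    (hc : ∀ᶠ h in 𝓝[>] (0 : ℝ), ContinuousOn (fun t => u (h, t)) (Set.Icc 0 h)) :
    (fun h => legendreCoeff (fun c => u (h, c * h)) j) =O[𝓝[>] 0] fun h => h ^ j := by
  obtain ⟨a, ha, hua⟩ := hu
  obtain ⟨C, hC0, hC⟩ := exists_bound_step hua
  obtain ⟨M, hM0, hM⟩ := exists_legendre_bound j
  refine IsBigO.of_bound (M * C) ?_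
  filter_upwards [hC, hc, self_mem_nhdsWithin] with h hC hc h0
  have h0 : 0 < h := h0
  have e : legendreCoeff (fun c => u (h, c * h)) j =
      legendreCoeff (fun c => u (h, c * h) - polyFam j a (h, c * h)) j := by
    simp only [polyFam_mul]
    rw [legendreCoeff_sub (continuousOn_comp_mul h0 hc) (continuous_poly _ _).continuousOn,
      legendreCoeff_poly, Finset.sum_eq_zero, sub_zero]
    intro k hk
    rw [integral_legendre_mul_pow_eq_zero j k (Finset.mem_range.mp hk), zero_smul]
  rw [e, Real.norm_of_nonneg (by positivity), mul_assoc]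
  exact norm_legendreCoeff_le hM0 hM fun c hc => hC _ (mul_mem_Icc_of_mem h0 hc)

theorem legendreProj_sub_bound {F : Type} [NormedAddCommGroup F] [NormedSpace ℝ F]
    [CompleteSpace F] {s : ℕ} {u : ℝ × ℝ → F} (hu : PolyApprox s u)
    (hc : ∀ᶠ h in 𝓝[>] (0 : ℝ), ContinuousOn (fun t => u (h, t)) (Set.Icc 0 h)) :
    ∃ C, 0 ≤ C ∧ ∀ᶠ h in 𝓝[>] (0 : ℝ), ∀ c ∈ Set.Icc (0 : ℝ) 1,
      ‖legendreProj s (fun c => u (h, c * h)) c - u (h, c * h)‖ ≤ C * h ^ s := by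
  obtain ⟨a, ha, hua⟩ := hu
  obtain ⟨C, hC0, hC⟩ := exists_bound_step hua
  obtain ⟨M, hM0, hM⟩ := exists_norm_legendreProj_sub_le s
  refine ⟨M * C, by positivity, ?_⟩
  filter_upwards [hC, hc, self_mem_nhdsWithin] with h hC hc h0 c hc1
  have h0 : 0 < h := h0
  rw [mul_assoc]
  refine hM (fun c => u (h, c * h)) (fun k => h ^ k • a k h) _ (continuousOn_comp_mul h0 hc)
    (fun c hc => ?_) c hc1
  rw [← polyFam_mul]
  exact hC _ (mul_mem_Icc_of_mem h0 hc)

theorem integral_legendreProj [CompleteSpace F] [CompleteSpace G] [CompleteSpace K]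
    (B : F →L[ℝ] G →L[ℝ] K) (s : ℕ) {u : ℝ → F} (hu : ContinuousOn u (Set.Icc 0 1))
    (v : ℝ → G) :
    ∫ c in (0 : ℝ)..1, B (u c) (legendreProj s v c) =
      ∑ j ∈ Finset.range s, B (legendreCoeff u j) (legendreCoeff v j) := by
  have e : ∀ c : ℝ, B (u c) (legendreProj s v c) = ∑ j ∈ Finset.range s,
      B.flip (legendreCoeff v j) ((legendre j).eval c • u c) := by
    intro c
    simp [legendreProj]
  simp only [e]
  rw [intervalIntegral.integral_finsetSum]
  · refine Finset.sum_congr rfl fun j _ => ?_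
    rw [ContinuousLinearMap.intervalIntegral_comp_comm _ (intervalIntegrable_legendre_smul hu j)]
    rfl
  · intro j _
    apply ContinuousOn.intervalIntegrable
    rw [Set.uIcc_of_le zero_le_one]
    exact (B.flip _).continuous.comp_continuousOn
      ((legendre j).continuous.continuousOn.smul hu)

/-- If `B(u, v)` vanishes on the step, its truncated Parseval sum is of order `2 s`. -/
theorem sum_bilinear_legendreCoeff_isBigO {F G K : Type} [NormedAddCommGroup F] [NormedSpace ℝ F]
    [NormedAddCommGroup G] [NormedSpace ℝ G] [NormedAddCommGroup K] [NormedSpace ℝ K]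
    [CompleteSpace F] [CompleteSpace G] [CompleteSpace K]
    (B : F →L[ℝ] G →L[ℝ] K) {s : ℕ} {u : ℝ × ℝ → F} {v : ℝ × ℝ → G}
    (hu : PolyApprox s u) (hv : PolyApprox s v)
    (huc : ∀ᶠ h in 𝓝[>] (0 : ℝ), ContinuousOn (fun t => u (h, t)) (Set.Icc 0 h))
    (hvc : ∀ᶠ h in 𝓝[>] (0 : ℝ), ContinuousOn (fun t => v (h, t)) (Set.Icc 0 h))
    (huv : ∀ᶠ h in 𝓝[>] (0 : ℝ), ∀ t ∈ Set.Icc 0 h, B (u (h, t)) (v (h, t)) = 0) :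
    (fun h => ∑ j ∈ Finset.range s, B (legendreCoeff (fun c => u (h, c * h)) j)
      (legendreCoeff (fun c => v (h, c * h)) j)) =O[𝓝[>] 0] fun h => h ^ (2 * s) := by
  obtain ⟨C₂, hC₂0, hC₂⟩ := legendreProj_sub_bound hv hvc
  obtain ⟨a, ha, hua⟩ := hu
  obtain ⟨C₁, hC₁0, hC₁⟩ := exists_bound_step hua
  refine IsBigO.of_bound (‖B‖ * C₁ * C₂) ?_
  filter_upwards [hC₁, hC₂, huc, hvc, huv, self_mem_nhdsWithin] with h hC₁ hC₂ huc hvc huv h0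
  have h0 : 0 < h := h0
  have hu1 := continuousOn_comp_mul h0 huc
  have hv1 := continuousOn_comp_mul h0 hvc
  set U : ℝ → F := fun c => u (h, c * h) with hU
  set V : ℝ → G := fun c => v (h, c * h) with hV
  set A : ℝ → F := fun c => ∑ k ∈ Finset.range s, c ^ k • (h ^ k • a k h) with hA
  have hAc : ContinuousOn A (Set.Icc 0 1) := (continuous_poly _ _).continuousOn
  have hW : ContinuousOn (fun c => legendreProj s V c - V c) (Set.Icc 0 1) :=
    (continuous_legendreProj s V).continuousOn.sub hv1
  have hBc : ∀ {f : ℝ → F} {g : ℝ → G}, ContinuousOn f (Set.Icc 0 1) →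
      ContinuousOn g (Set.Icc 0 1) →
      IntervalIntegrable (fun c => B (f c) (g c)) MeasureTheory.volume 0 1 := by
    intro f g hf hg
    apply ContinuousOn.intervalIntegrable
    rw [Set.uIcc_of_le zero_le_one]
    exact (B.continuous.comp_continuousOn hf).clm_apply hg
  -- The sum is `∫ B(U, PV)`. Subtracting `V` costs nothing since `B(U, V) = 0`, and subtracting the
  -- polynomial `A` costs nothing by orthogonality; both remaining factors are `O(h^s)`.
  have e : ∑ j ∈ Finset.range s, B (legendreCoeff U j) (legendreCoeff V j) =
      ∫ c in (0 : ℝ)..1, B (U c - A c) (legendreProj s V c - V c) := by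
    rw [← integral_legendreProj B s hu1 V]
    have h1 : ∫ c in (0 : ℝ)..1, B (U c) (legendreProj s V c) =
        ∫ c in (0 : ℝ)..1, B (U c) (legendreProj s V c - V c) := by
      refine intervalIntegral.integral_congr fun c hc => ?_
      rw [Set.uIcc_of_le zero_le_one] at hc
      simp only [map_sub, huv _ (mul_mem_Icc_of_mem h0 hc), sub_zero, hU, hV]
    have h2 := integral_poly_legendreProj_sub B s (fun k => h ^ k • a k h) hv1
    rw [h1, ← sub_zero (∫ c in (0 : ℝ)..1, B (U c) (legendreProj s V c - V c)), ← h2,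
      ← intervalIntegral.integral_sub (hBc hu1 hW) (hBc hAc hW)]
    simp only [map_sub B, sub_apply, hA]
  rw [e, Real.norm_of_nonneg (by positivity)]
  have := intervalIntegral.norm_integral_le_of_norm_le_const (a := (0 : ℝ)) (b := 1)
    (f := fun c => B (U c - A c) (legendreProj s V c - V c))
    (C := ‖B‖ * (C₁ * h ^ s) * (C₂ * h ^ s)) fun c hc => by
      rw [Set.uIoc_of_le zero_le_one] at hc
      have hc' := Set.Ioc_subset_Icc_self hc
      refine B.le_of_opNorm₂_le_of_le le_rfl ?_ (hC₂ c hc')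
      have := hC₁ _ (mul_mem_Icc_of_mem h0 hc')
      rwa [polyFam_mul] at this
  refine this.trans (le_of_eq ?_)
  simp only [sub_zero, abs_one]
  ring

end

end ELIM

/-! ### Superconvergence at the end of the step by duality -/

namespace ELIM

open Filter Asymptotics

/-- A family of curves `σ h` on `[0,h]` in `Ω`, issuing from `y₀`, with derivatives `σ'` that are
approximated by polynomials to every order, uniformly in `h`. -/
structure StepCurve {E : Type} [NormedAddCommGroup E] [NormedSpace ℝ E] (Ω : Set E) (y₀ : E)
    (σ : ℝ → ℝ → E) (σ' : ℝ × ℝ → E) : Prop where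
  hasDerivAt : ∀ᶠ h in 𝓝[>] (0 : ℝ), ∀ t ∈ Set.Icc 0 h, HasDerivAt (σ h) (σ' (h, t)) t
  continuousOn : ∀ᶠ h in 𝓝[>] (0 : ℝ), ContinuousOn (fun t => σ' (h, t)) (Set.Icc 0 h)
  init : ∀ᶠ h in 𝓝[>] (0 : ℝ), σ h 0 = y₀
  mem : ∀ᶠ h in 𝓝[>] (0 : ℝ), ∀ t ∈ Set.Icc 0 h, σ h t ∈ Ω
  approx : ∀ n, PolyApprox n σ'

section

variable {E : Type} [NormedAddCommGroup E] [NormedSpace ℝ E] {Ω : Set E} {y₀ : E}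
  {σ : ℝ → ℝ → E} {σ' : ℝ × ℝ → E}

theorem StepCurve.tendsto (hσ : StepCurve Ω y₀ σ σ') :
    Tendsto (fun x : ℝ × ℝ => σ x.1 x.2) stepFilter (𝓝 y₀) := by
  have h1 : (fun x : ℝ × ℝ => σ x.1 x.2 - σ x.1 0) =O[stepFilter] fun x => x.1 ^ (0 + 1) := by
    refine isBigO_step_of_hasDerivWithinAt (u := fun x => σ x.1 x.2) (u' := σ') (n := 0) ?_
      (by simpa using (hσ.approx 0).isBigO_one)
    filter_upwards [hσ.hasDerivAt] with h hh t ht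
    exact (hh t ht).hasDerivWithinAt
  have h2 : Tendsto (fun x : ℝ × ℝ => x.1 ^ (0 + 1)) stepFilter (𝓝 0) := by
    simpa using tendsto_fst_stepFilter.mono_right nhdsWithin_le_nhds
  have h3 := (h1.trans_tendsto h2).add_const y₀
  rw [zero_add] at h3
  refine h3.congr' ?_
  filter_upwards [tendsto_fst_stepFilter.eventually hσ.init] with x hx
  rw [hx, sub_add_cancel]

theorem StepCurve.polyApprox_comp (hσ : StepCurve Ω y₀ σ σ') (hΩ : IsOpen Ω) (hy₀ : y₀ ∈ Ω)
    (n : ℕ) {F : Type} [NormedAddCommGroup F] [NormedSpace ℝ F] {g : E → F}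
    (hg : ContDiffOn ℝ ∞ g Ω) : PolyApprox n fun x => g (σ x.1 x.2) :=
  PolyApprox.comp_contDiffOn hΩ hy₀ hσ.hasDerivAt hσ.init hσ.mem hσ.approx hσ.tendsto n hg

theorem StepCurve.continuousOn_comp (hσ : StepCurve Ω y₀ σ σ')
    {F : Type} [TopologicalSpace F] {g : E → F} (hg : ContinuousOn g Ω) :
    ∀ᶠ h in 𝓝[>] (0 : ℝ), ContinuousOn (fun t => g (σ h t)) (Set.Icc 0 h) := by
  filter_upwards [hσ.hasDerivAt, hσ.mem] with h hd hm
  exact hg.comp (fun t ht => (hd t ht).continuousAt.continuousWithinAt) hm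

/-- An approximate fundamental solution of the adjoint linear equation `Z' = -Z A`, polynomial
in `t`. -/
theorem exists_adjoint_solution (n : ℕ) {A : ℝ × ℝ → E →L[ℝ] E} (hA : PolyApprox n A) :
    ∃ (z : ℕ → ℝ → E →L[ℝ] E) (Z' : ℝ × ℝ → E →L[ℝ] E),
      (∀ k, z k =O[𝓝[>] 0] fun _ => (1 : ℝ)) ∧ (∀ h, z 0 h = 1) ∧
      (∀ h t, HasDerivAt (fun t => polyFam (n + 1) z (h, t)) (Z' (h, t)) t) ∧
      (∀ h, Continuous fun t => Z' (h, t)) ∧ (∀ m, PolyApprox m Z') ∧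
      (fun x => Z' x + polyFam (n + 1) z x * A x) =O[stepFilter] fun x => x.1 ^ n := by
  induction n with
  | zero =>
    refine ⟨fun k _ => if k = 0 then 1 else 0, fun _ => 0, fun k => isBigO_const_const _ one_ne_zero _,
      fun h => rfl, fun h t => ?_, fun h => continuous_const, fun m => ?_, ?_⟩
    · simpa [polyFam] using hasDerivAt_const t (1 : E →L[ℝ] E)
    · exact .of_isBigO (isBigO_zero _ _)
    · simpa [polyFam] using hA.isBigO_one
  | succ n ih =>
    obtain ⟨z, Z', hz, hz0, hd, hcont, hZ', hO⟩ := ih (hA.mono n.le_succ)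
    have hZ := fun m => polyApprox_polyFam m (n + 1) hz
    have hU : PolyApprox (n + 1) fun x => Z' x + polyFam (n + 1) z x * A x :=
      (hZ' _).add ((hZ _).bilinear (ContinuousLinearMap.mul ℝ (E →L[ℝ] E)) hA)
    -- Replace the residual `Z' + ZA` by its polynomial part `w`, itself `O(h^n)`, and subtract the
    -- primitive `q` of `w` from `Z`. The new residual is `(Z' + ZA - w) - qA`, where both parts are
    -- `O(h^{n+1})`.
    obtain ⟨w, hw, hUw⟩ := hU
    have hwO : polyFam (n + 1) w =O[stepFilter] fun x => x.1 ^ n :=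
      (hO.sub (hUw.trans (isBigO_pow_step n.le_succ))).congr_left fun x => by simp
    let q : ℝ × ℝ → E →L[ℝ] E := fun x =>
      ∑ k ∈ Finset.range (n + 1), x.2 ^ (k + 1) • ((k + 1 : ℝ)⁻¹ • w k x.1)
    have hqd : ∀ h t, HasDerivAt (fun t => q (h, t)) (polyFam (n + 1) w (h, t)) t :=
      fun h t => hasDerivAt_polyFam_primitive (n + 1) w h t
    have hqO : q =O[stepFilter] fun x => x.1 ^ (n + 1) := by
      have := isBigO_step_of_hasDerivWithinAt (u := q)
        (Eventually.of_forall fun h t _ => (hqd h t).hasDerivWithinAt) hwO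
      refine this.congr_left fun x => ?_
      simp [q]
    -- `polyFam (n + 1) z` only sees `z 0, …, z n`; the later coefficients must be cut off before
    -- the degree is raised by one.
    let z' : ℕ → ℝ → E →L[ℝ] E := fun k h => match k with
      | 0 => z 0 h
      | k + 1 => (if k < n then z (k + 1) h else 0) - (k + 1 : ℝ)⁻¹ • w k h
    have hz' : ∀ x, polyFam (n + 2) z' x = polyFam (n + 1) z x - q x := by
      intro x
      simp only [polyFam, q]
      rw [Finset.sum_range_succ' (fun k => x.2 ^ k • z' k x.1),
        Finset.sum_range_succ' (fun k => x.2 ^ k • z k x.1)]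
      simp only [z', smul_sub, Finset.sum_sub_distrib]
      rw [Finset.sum_range_succ (fun k => x.2 ^ (k + 1) • (if k < n then z (k + 1) x.1 else 0)),
        Finset.sum_congr rfl (g := fun k => x.2 ^ (k + 1) • z (k + 1) x.1)
          fun k hk => by rw [if_pos (Finset.mem_range.mp hk)]]
      simp only [lt_irrefl, if_false, smul_zero, add_zero]
      abel
    refine ⟨z', fun x => Z' x - polyFam (n + 1) w x, ?_, hz0, ?_, ?_, ?_, ?_⟩
    · rintro (_ | k)
      · exact hz 0
      · refine IsBigO.sub ?_ ((hw k).const_smul_left (k + 1 : ℝ)⁻¹)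
        by_cases hk : k < n
        · simpa [hk] using hz (k + 1)
        · simpa [hk] using isBigO_zero (E' := E →L[ℝ] E) (fun _ : ℝ => (1 : ℝ)) (𝓝[>] (0 : ℝ))
    · intro h t
      simp only [hz']
      exact (hd h t).sub (hqd h t)
    · intro h
      exact (hcont h).sub (continuous_poly (n + 1) fun k => w k h)
    · intro m
      have := (hZ' m).add (polyApprox_polyFam m (n + 1) (a := fun k h => -w k h)
        fun k => (hw k).neg_left)
      exact this.congr' (Eventually.of_forall fun x => by simp [polyFam, sub_eq_add_neg])
    · have h1 := isBigO_bilinear (ContinuousLinearMap.mul ℝ (E →L[ℝ] E)) hqO hA.isBigO_one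
      simp only [mul_one] at h1
      refine (hUw.sub h1).congr_left fun x => ?_
      simp only [hz', sub_mul, ContinuousLinearMap.mul_apply']
      abel

/-- Lipschitz and quadratic Taylor estimates near a point. -/
theorem exists_local_estimates {F : Type} [NormedAddCommGroup F] [NormedSpace ℝ F] {f : E → F}
    (hf : ContDiffAt ℝ 2 f y₀) : ∃ K, 0 < K ∧ ∃ U ∈ 𝓝 y₀, ∀ x ∈ U, ∀ y ∈ U,
      ‖f x - f y‖ ≤ K * ‖x - y‖ ∧ ‖f y - f x - fderiv ℝ f x (y - x)‖ ≤ K * ‖y - x‖ ^ 2 := by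
  obtain ⟨K₁, U₁, hU₁, hK₁⟩ := (hf.of_le one_le_two).exists_lipschitzOnWith
  obtain ⟨K₂, U₂, hU₂, hK₂⟩ :=
    (hf.fderiv_right (m := 1) (by norm_num)).exists_lipschitzOnWith
  have hd : ∀ᶠ x in 𝓝 y₀, DifferentiableAt ℝ f x := by
    filter_upwards [hf.eventually (by simp)] with x hx
    exact hx.differentiableAt (by simp)
  obtain ⟨ρ, hρ, hsub⟩ := Metric.mem_nhds_iff.1 (inter_mem (inter_mem hU₁ hU₂) hd)
  refine ⟨K₁ + K₂ + 1, by positivity, Metric.ball y₀ ρ, Metric.ball_mem_nhds _ hρ,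
    fun x hx y hy => ⟨?_, ?_⟩⟩
  · refine (hK₁.norm_sub_le (hsub hx).1.1 (hsub hy).1.1).trans ?_
    gcongr
    have : (0 : ℝ) ≤ K₂ := K₂.2
    linarith
  · have hseg : segment ℝ x y ⊆ Metric.ball y₀ ρ := (convex_ball y₀ ρ).segment_subset hx hy
    -- Mean value inequality for `f - f'(x)`, whose derivative on the segment is at most `K₂ ‖y -
    -- x‖`.
    have := (convex_segment x y).norm_image_sub_le_of_norm_hasFDerivWithin_le' (f := f)
      (f' := fun x => fderiv ℝ f x) (φ := fderiv ℝ f x) (C := K₂ * ‖y - x‖)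
      (fun w hw => (hsub (hseg hw)).2.hasFDerivAt.hasFDerivWithinAt) (fun w hw => ?_)
      (left_mem_segment ℝ x y) (right_mem_segment ℝ x y)
    · refine this.trans ?_
      rw [mul_assoc, ← pow_two]
      gcongr
      have : (0 : ℝ) ≤ K₁ := K₁.2
      linarith
    · refine (hK₂.norm_sub_le (hsub (hseg hw)).1.2 (hsub hx).1.2).trans ?_
      gcongr
      obtain ⟨a, b, ha, hb, hab, rfl⟩ := hw
      have : a • x + b • y - x = b • (y - x) := by
        rw [← eq_sub_iff_add_eq] at hab
        rw [hab, sub_smul, smul_sub, one_smul]; abel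
      rw [this, norm_smul, Real.norm_of_nonneg hb]
      exact mul_le_of_le_one_left (norm_nonneg _) (by linarith)

theorem integral_step_isBigO {g : ℝ × ℝ → E} {n : ℕ} (hg : g =O[stepFilter] fun x => x.1 ^ n) :
    (fun h => ∫ t in (0 : ℝ)..h, g (h, t)) =O[𝓝[>] 0] fun h => h ^ (n + 1) := by
  obtain ⟨C, hC0, hC⟩ := exists_bound_step hg
  refine IsBigO.of_bound C ?_
  filter_upwards [hC, self_mem_nhdsWithin] with h hC h0
  have h0 : 0 < h := h0
  have := intervalIntegral.norm_integral_le_of_norm_le_const (a := (0 : ℝ)) (b := h)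
    (f := fun t => g (h, t)) (C := C * h ^ n) fun t ht => by
      rw [Set.uIoc_of_le h0.le] at ht
      exact hC t (Set.Ioc_subset_Icc_self ht)
  refine this.trans (le_of_eq ?_)
  rw [sub_zero, abs_of_pos h0, Real.norm_of_nonneg (by positivity)]
  ring

variable {f : E → E} {T : ℝ} {y : ℝ → E}

theorem tendsto_solution (hT : 0 < T) (hy0 : y 0 = y₀)
    (hy : ∀ t ∈ Set.Icc 0 T, HasDerivWithinAt y (f (y t)) (Set.Icc 0 T) t) :
    Tendsto (fun x : ℝ × ℝ => y x.2) stepFilter (𝓝 y₀) := by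
  have hc : ContinuousWithinAt y (Set.Icc 0 T) 0 := (hy 0 ⟨le_rfl, hT.le⟩).continuousWithinAt
  rw [ContinuousWithinAt, hy0] at hc
  refine hc.comp (tendsto_nhdsWithin_iff.2 ⟨?_, ?_⟩)
  · have h2 : Tendsto (fun x : ℝ × ℝ => x.1) stepFilter (𝓝 0) :=
      tendsto_fst_stepFilter.mono_right nhdsWithin_le_nhds
    exact isBigO_snd_fst.trans_tendsto h2
  · refine eventually_stepFilter.2 ?_
    filter_upwards [Ioc_mem_nhdsGT hT] with h hh t ht
    exact ⟨ht.1, ht.2.trans hh.2⟩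

/-- In place of Grönwall: the maximum `M` of the error on `[0,h]` satisfies `M ≤ (K M + C h^s) h`,
and `K h ≤ 1/2` absorbs the first term. -/
theorem StepCurve.sub_solution_isBigO (hσ : StepCurve Ω y₀ σ σ')
    (hf : ContDiffAt ℝ 2 f y₀) (hT : 0 < T) (hy0 : y 0 = y₀)
    (hy : ∀ t ∈ Set.Icc 0 T, HasDerivWithinAt y (f (y t)) (Set.Icc 0 T) t) {s : ℕ}
    (hr : (fun x : ℝ × ℝ => σ' x - f (σ x.1 x.2)) =O[stepFilter] fun x => x.1 ^ s) :
    (fun x : ℝ × ℝ => σ x.1 x.2 - y x.2) =O[stepFilter] fun x => x.1 ^ (s + 1) := by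
  obtain ⟨K, hK0, U, hU, hK⟩ := exists_local_estimates hf
  obtain ⟨C, hC0, hC⟩ := exists_bound_step hr
  have hσU := eventually_stepFilter.1 (hσ.tendsto.eventually hU)
  have hyU := eventually_stepFilter.1 ((tendsto_solution hT hy0 hy).eventually hU)
  refine isBigO_step_of_bound (2 * C) ?_
  have hhK : ∀ᶠ h in 𝓝[>] (0 : ℝ), h ∈ Set.Ioc 0 (1 / (2 * K)) :=
    Ioc_mem_nhdsGT (by positivity)
  filter_upwards [hC, hσU, hyU, hσ.hasDerivAt, hσ.init, hhK, Ioc_mem_nhdsGT hT]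
    with h hC hσU hyU hd h0 hhK hhT t ht
  have hh0 : 0 < h := hhT.1
  have hKh : K * h ≤ 1 / 2 := by
    have := mul_le_mul_of_nonneg_left hhK.2 hK0.le
    field_simp at this ⊢
    linarith
  have hed : ∀ t ∈ Set.Icc 0 h,
      HasDerivWithinAt (fun t => σ h t - y t) (σ' (h, t) - f (y t)) (Set.Icc 0 h) t :=
    fun t ht => (hd t ht).hasDerivWithinAt.sub
      ((hy t ⟨ht.1, ht.2.trans hhT.2⟩).mono (Set.Icc_subset_Icc_right hhT.2))
  obtain ⟨t₀, ht₀, hmax⟩ := isCompact_Icc.exists_isMaxOn (s := Set.Icc 0 h) ⟨0, le_rfl, hh0.le⟩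
    (fun t ht => (hed t ht).continuousWithinAt.norm :
      ContinuousOn (fun t => ‖σ h t - y t‖) (Set.Icc 0 h))
  set M := ‖σ h t₀ - y t₀‖ with hM
  have hmax' : ∀ t ∈ Set.Icc 0 h, ‖σ h t - y t‖ ≤ M := fun t ht => hmax ht
  have hb := norm_image_sub_le_of_norm_deriv_le_segment' (C := K * M + C * h ^ s) hed
    (fun t ht => by
      have ht := Set.Ico_subset_Icc_self ht
      have e : σ' (h, t) - f (y t) = (f (σ h t) - f (y t)) + (σ' (h, t) - f (σ h t)) := by abel
      rw [e]
      refine (norm_add_le _ _).trans (add_le_add ?_ (hC t ht))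
      exact (hK _ (hσU t ht) _ (hyU t ht)).1.trans
        (mul_le_mul_of_nonneg_left (hmax' t ht) hK0.le)) t₀ ht₀
  rw [h0, hy0, sub_self, sub_zero, sub_zero, ← hM] at hb
  have hM0 : 0 ≤ M := norm_nonneg _
  have hs0 : 0 ≤ C * h ^ s := by positivity
  have h1 : M ≤ (K * M + C * h ^ s) * h :=
    hb.trans (mul_le_mul_of_nonneg_left ht₀.2 (by positivity))
  have h2 : K * h * M ≤ 1 / 2 * M := mul_le_mul_of_nonneg_right hKh hM0
  refine (hmax' t ht).trans ?_
  rw [pow_succ]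
  nlinarith

/-- Superconvergence at the end of the step: a residual of order `s` whose moments against
polynomials of degree less than `s` are of order `2 s` gives an error of order `2 s + 1`. -/
theorem StepCurve.end_error_isBigO [CompleteSpace E] (hσ : StepCurve Ω y₀ σ σ') (hΩ : IsOpen Ω)
    (hy₀ : y₀ ∈ Ω) (hf : ContDiffOn ℝ ∞ f Ω) (hT : 0 < T) (hy0 : y 0 = y₀)
    (hy : ∀ t ∈ Set.Icc 0 T, y t ∈ Ω ∧ HasDerivWithinAt y (f (y t)) (Set.Icc 0 T) t) {s : ℕ}
    (hs : 0 < s)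
    (hr : (fun x : ℝ × ℝ => σ' x - f (σ x.1 x.2)) =O[stepFilter] fun x => x.1 ^ s)
    (hmom : ∀ z : ℕ → ℝ → E →L[ℝ] E, (∀ k, z k =O[𝓝[>] 0] fun _ => (1 : ℝ)) →
      (fun h => ∫ c in (0 : ℝ)..1,
        polyFam s z (h, c * h) (σ' (h, c * h) - f (σ h (c * h)))) =O[𝓝[>] 0]
          fun h => h ^ (2 * s)) :
    (fun h => σ h h - y h) =O[𝓝[>] 0] fun h => h ^ (2 * s + 1) := by
  obtain ⟨n, rfl⟩ : ∃ n, s = n + 1 := ⟨s - 1, by lia⟩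
  have hf2 : ContDiffAt ℝ 2 f y₀ :=
    mod_cast contDiffAt_infty.1 (hf.contDiffAt (hΩ.mem_nhds hy₀)) 2
  have hy' := fun t ht => (hy t ht).2
  have he := hσ.sub_solution_isBigO hf2 hT hy0 hy' hr
  have hA : PolyApprox n fun x => fderiv ℝ f (σ x.1 x.2) :=
    hσ.polyApprox_comp hΩ hy₀ n (hf.fderiv_of_isOpen hΩ (by simp))
  -- `Z` has degree at most `n = s - 1`, as the moment hypothesis requires. Its residual is then
  -- only `O(h^{s-1})`, which suffices because it multiplies an error `O(h^{s+1})`.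
  obtain ⟨z, Z', hz, hz0, hZd, hZc, hZ', hZO⟩ := exists_adjoint_solution n hA
  have hZ1 := (polyApprox_polyFam 0 (n + 1) hz).isBigO_one
  -- the quadratic remainder
  obtain ⟨K, hK0, U, hU, hK⟩ := exists_local_estimates hf2
  have hq : (fun x : ℝ × ℝ => f (σ x.1 x.2) - f (y x.2) -
      fderiv ℝ f (σ x.1 x.2) (σ x.1 x.2 - y x.2)) =O[stepFilter]
        fun x => x.1 ^ (2 * (n + 1)) := by
    have h1 : (fun x : ℝ × ℝ => f (σ x.1 x.2) - f (y x.2) -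
        fderiv ℝ f (σ x.1 x.2) (σ x.1 x.2 - y x.2)) =O[stepFilter]
        fun x => ‖σ x.1 x.2 - y x.2‖ ^ 2 := by
      refine IsBigO.of_bound K ?_
      filter_upwards [hσ.tendsto.eventually hU, (tendsto_solution hT hy0 hy').eventually hU]
        with x h1 h2
      have := (hK _ h1 _ h2).2
      have e : f (σ x.1 x.2) - f (y x.2) - fderiv ℝ f (σ x.1 x.2) (σ x.1 x.2 - y x.2) =
          -(f (y x.2) - f (σ x.1 x.2) - fderiv ℝ f (σ x.1 x.2) (y x.2 - σ x.1 x.2)) := by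
        rw [← neg_sub (y x.2) (σ x.1 x.2), map_neg]
        abel
      rw [norm_pow, norm_norm, norm_sub_rev (σ x.1 x.2) (y x.2), e, norm_neg]
      exact this
    refine (h1.trans (he.norm_left.pow 2)).trans ?_
    simp only [← pow_mul]
    exact isBigO_pow_step (by lia)
  have hg : (fun x : ℝ × ℝ =>
      (Z' x + polyFam (n + 1) z x * fderiv ℝ f (σ x.1 x.2)) (σ x.1 x.2 - y x.2) +
      polyFam (n + 1) z x (f (σ x.1 x.2) - f (y x.2) -
        fderiv ℝ f (σ x.1 x.2) (σ x.1 x.2 - y x.2))) =O[stepFilter]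
        fun x => x.1 ^ (2 * (n + 1)) := by
    refine IsBigO.add ?_ ?_
    · refine (isBigO_bilinear (ContinuousLinearMap.id ℝ (E →L[ℝ] E)) hZO he).trans ?_
      simp only [← pow_add]
      exact isBigO_pow_step (by lia)
    · simpa using isBigO_bilinear (ContinuousLinearMap.id ℝ (E →L[ℝ] E)) hZ1 hq
  -- With `e = σ - y`, `A = f'(σ)`, residual `r` and quadratic remainder `ρ`, `(Ze)' = (Z' + ZA) e +
  -- Zρ + Zr`. The first two terms are bounded by `hg`; the last integrates to `h` times a moment of
  -- `r`, and `e(0) = 0`.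
  have hW : (fun h => polyFam (n + 1) z (h, h) (σ h h - y h)) =O[𝓝[>] 0]
      fun h => h ^ (2 * (n + 1) + 1) := by
    have h1 := integral_step_isBigO hg
    have h2 := (isBigO_refl (fun h : ℝ => h) (𝓝[>] 0)).smul (hmom z hz)
    simp only [smul_eq_mul, ← pow_succ'] at h2
    refine (h1.add h2).congr' ?_ EventuallyEq.rfl
    filter_upwards [hσ.hasDerivAt, hσ.continuousOn, hσ.init, hσ.mem,
      hσ.continuousOn_comp hf.continuousOn, hσ.continuousOn_comp (g := fun x => x) continuousOn_id,
      hσ.continuousOn_comp (hf.continuousOn_fderiv_of_isOpen hΩ (by simp)),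
      Ioc_mem_nhdsGT hT] with h hd hc h0 hmem hfσ hσc hAc hhT
    have hh0 : 0 < h := hhT.1
    have hyd : ∀ t ∈ Set.Icc 0 h, HasDerivWithinAt y (f (y t)) (Set.Icc 0 h) t := fun t ht =>
      (hy' t ⟨ht.1, ht.2.trans hhT.2⟩).mono (Set.Icc_subset_Icc_right hhT.2)
    have hyc : ContinuousOn y (Set.Icc 0 h) := fun t ht => (hyd t ht).continuousWithinAt
    have hfy : ContinuousOn (fun t => f (y t)) (Set.Icc 0 h) :=
      hf.continuousOn.comp hyc fun t ht => (hy t ⟨ht.1, ht.2.trans hhT.2⟩).1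
    have hZcont : Continuous fun t => polyFam (n + 1) z (h, t) :=
      continuous_poly (n + 1) fun k => z k h
    have hWd : ∀ t ∈ Set.Icc 0 h,
        HasDerivWithinAt (fun t => polyFam (n + 1) z (h, t) (σ h t - y t))
          (Z' (h, t) (σ h t - y t) + polyFam (n + 1) z (h, t) (σ' (h, t) - f (y t)))
          (Set.Icc 0 h) t := fun t ht =>
      (hZd h t).hasDerivWithinAt.clm_apply ((hd t ht).hasDerivWithinAt.sub (hyd t ht))
    have hII : ∀ {g : ℝ → E}, ContinuousOn g (Set.Icc 0 h) →
        IntervalIntegrable g MeasureTheory.volume 0 h := fun hg =>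
      ContinuousOn.intervalIntegrable (by rwa [Set.uIcc_of_le hh0.le])
    have hW'c : ContinuousOn (fun t => Z' (h, t) (σ h t - y t) +
        polyFam (n + 1) z (h, t) (σ' (h, t) - f (y t))) (Set.Icc 0 h) :=
      ((hZc h).continuousOn.clm_apply (hσc.sub hyc)).add
        (hZcont.continuousOn.clm_apply (hc.sub hfy))
    have hftc := intervalIntegral.integral_eq_sub_of_hasDerivAt_of_le hh0.le
      (fun t ht => (hWd t ht).continuousWithinAt)
      (fun t ht => (hWd t (Set.Ioo_subset_Icc_self ht)).hasDerivAt (Icc_mem_nhds ht.1 ht.2))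
      (hII hW'c)
    have h3 := intervalIntegral.smul_integral_comp_mul_right (a := (0 : ℝ)) (b := 1)
      (fun t => polyFam (n + 1) z (h, t) (σ' (h, t) - f (σ h t))) h
    rw [zero_mul, one_mul] at h3
    have hec := hσc.sub hyc
    rw [h3, ← intervalIntegral.integral_add]
    · rw [h0, hy0, sub_self, map_zero, sub_zero] at hftc
      rw [← hftc]
      refine intervalIntegral.integral_congr fun t _ => ?_
      simp only [add_apply, mul_apply_eq_comp, map_sub]
      abel
    · refine hII (ContinuousOn.add (ContinuousOn.clm_apply ?_ hec)
        (hZcont.continuousOn.clm_apply ((hfσ.sub hfy).sub (hAc.clm_apply hec))))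
      exact (hZc h).continuousOn.add (hZcont.continuousOn.mul hAc)
    · exact hII (hZcont.continuousOn.clm_apply (hc.sub hfσ))
  -- `Z(h)` is close to the identity, so `‖e(h)‖ ≤ 2 ‖Z(h) e(h)‖`.
  have hZ2 : ∀ᶠ h in 𝓝[>] (0 : ℝ), ‖polyFam (n + 1) z (h, h) - 1‖ ≤ 1 / 2 := by
    have h1 := isBigO_step_of_hasDerivWithinAt (u := polyFam (n + 1) z) (u' := Z') (n := 0)
      (Eventually.of_forall fun h t _ => (hZd h t).hasDerivWithinAt)
      (by simpa using (hZ' 0).isBigO_one)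
    have h2 : Tendsto (fun x : ℝ × ℝ => x.1 ^ (0 + 1)) stepFilter (𝓝 0) := by
      simpa using tendsto_fst_stepFilter.mono_right nhdsWithin_le_nhds
    have h3 := ((h1.trans_tendsto h2).comp tendsto_step_end).norm
    rw [norm_zero] at h3
    filter_upwards [h3.eventually (ge_mem_nhds (show (0 : ℝ) < 1 / 2 by norm_num))] with h hh
    have e : polyFam (n + 1) z (h, 0) = 1 := by
      simp [polyFam, Finset.sum_range_succ', hz0]
    simpa [e] using hh
  refine IsBigO.trans (IsBigO.of_bound 2 ?_) hW
  filter_upwards [hZ2] with h hh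
  have h1 := (polyFam (n + 1) z (h, h) - 1).le_of_opNorm_le hh (σ h h - y h)
  have h2 := norm_sub_le (polyFam (n + 1) z (h, h) (σ h h - y h))
    ((polyFam (n + 1) z (h, h) - 1) (σ h h - y h))
  have h3 : polyFam (n + 1) z (h, h) (σ h h - y h) -
      (polyFam (n + 1) z (h, h) - 1) (σ h h - y h) = σ h h - y h := by
    simp only [sub_apply, one_apply_eq_self]; abel
  rw [h3] at h2
  linarith

end

end ELIM

/-! ### Polynomial curves, perturbed projections and linear systems -/

namespace ELIM

open Filter Asymptotics

section

variable {E : Type} [NormedAddCommGroup E] [NormedSpace ℝ E]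

theorem hasDerivAt_poly (n : ℕ) (p : ℕ → E) (t : ℝ) :
    HasDerivAt (fun t : ℝ => ∑ i ∈ Finset.range (n + 1), t ^ i • p i)
      (∑ i ∈ Finset.range n, t ^ i • ((i + 1 : ℝ) • p (i + 1))) t := by
  have h : HasDerivAt (fun t : ℝ => ∑ i ∈ Finset.range n, t ^ (i + 1) • p (i + 1))
      (∑ i ∈ Finset.range n, t ^ i • ((i + 1 : ℝ) • p (i + 1))) t := by
    refine HasDerivAt.fun_sum fun k _ => ?_
    convert (hasDerivAt_pow (k + 1) t).smul_const (p (k + 1)) using 1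
    rw [smul_smul, mul_comm]
    simp
  simpa only [Finset.sum_range_succ', pow_zero, one_smul] using h.add_const (p 0)

theorem iteratedDeriv_poly_zero (k n : ℕ) (hk : k ≤ n) (p : ℕ → E) :
    iteratedDeriv k (fun t : ℝ => ∑ i ∈ Finset.range (n + 1), t ^ i • p i) 0 =
      (k.factorial : ℝ) • p k := by
  induction k generalizing n p with
  | zero => simp [Finset.sum_range_succ']
  | succ k ih =>
    obtain ⟨n, rfl⟩ : ∃ n', n = n' + 1 := ⟨n - 1, by lia⟩
    rw [iteratedDeriv_succ']
    have : deriv (fun t : ℝ => ∑ i ∈ Finset.range (n + 1 + 1), t ^ i • p i) =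
        fun t => ∑ i ∈ Finset.range (n + 1), t ^ i • ((i + 1 : ℝ) • p (i + 1)) :=
      funext fun t => (hasDerivAt_poly (n + 1) p t).deriv
    rw [this, ih n (by lia), smul_smul, Nat.factorial_succ]
    push_cast
    rw [mul_comm]

/-- Polynomials of degree at most `s` with bounded Taylor coefficients. -/
theorem stepCurve_of_poly {Ω : Set E} {y₀ : E} {σ : ℝ → ℝ → E} (s : ℕ)
    (hpoly : ∀ᶠ h in 𝓝[>] (0 : ℝ),
      ∃ p : ℕ → E, ∀ t, σ h t = ∑ i ∈ Finset.range (s + 1), t ^ i • p i)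
    (hinit : ∀ᶠ h in 𝓝[>] (0 : ℝ), σ h 0 = y₀)
    (hmem : ∀ᶠ h in 𝓝[>] (0 : ℝ), ∀ t ∈ Set.Icc 0 h, σ h t ∈ Ω)
    (hT : ∀ k ≤ s, (fun h : ℝ => iteratedDeriv k (σ h) 0) =O[𝓝[>] 0] fun _ => (1 : ℝ)) :
    StepCurve Ω y₀ σ fun x => deriv (σ x.1) x.2 := by
  -- Taylor coefficients as functions of `h`, cut off beyond `s`, where no bound is assumed.
  let p : ℕ → ℝ → E := fun k h =>
    if k ≤ s then (k.factorial : ℝ)⁻¹ • iteratedDeriv k (σ h) 0 else 0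
  have hp : ∀ k, p k =O[𝓝[>] 0] fun _ => (1 : ℝ) := by
    intro k
    by_cases hk : k ≤ s
    · simpa [p, hk] using (hT k hk).const_smul_left (k.factorial : ℝ)⁻¹
    · simpa [p, hk] using isBigO_zero (E' := E) (fun _ : ℝ => (1 : ℝ)) (𝓝[>] (0 : ℝ))
  let p' : ℕ → ℝ → E := fun k h => (k + 1 : ℝ) • p (k + 1) h
  have hp' : ∀ k, p' k =O[𝓝[>] 0] fun _ => (1 : ℝ) :=
    fun k => (hp (k + 1)).const_smul_left (k + 1 : ℝ)
  have hd : ∀ᶠ h in 𝓝[>] (0 : ℝ), ∀ t, HasDerivAt (σ h) (polyFam s p' (h, t)) t := by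
    filter_upwards [hpoly] with h hh t
    obtain ⟨q, hq⟩ := hh
    have hq' : σ h = fun t => ∑ i ∈ Finset.range (s + 1), t ^ i • q i := funext hq
    have hpq : σ h = fun t => ∑ i ∈ Finset.range (s + 1), t ^ i • p i h := by
      rw [hq']
      funext t
      refine Finset.sum_congr rfl fun k hk => ?_
      have hk : k ≤ s := by simpa [Nat.lt_succ_iff] using hk
      have hf : (k.factorial : ℝ) ≠ 0 := by positivity
      simp only [p, hk, if_true, hq', iteratedDeriv_poly_zero k s hk, smul_smul,
        inv_mul_cancel₀ hf, one_smul]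
    rw [hpq]
    exact hasDerivAt_poly s (fun k => p k h) t
  have hderiv : ∀ᶠ h in 𝓝[>] (0 : ℝ), ∀ t, polyFam s p' (h, t) = deriv (σ h) t := by
    filter_upwards [hd] with h hh t using (hh t).deriv.symm
  refine ⟨?_, ?_, hinit, hmem, fun n => ?_⟩
  · filter_upwards [hd] with h hd t _
    exact (hd t).differentiableAt.hasDerivAt
  · filter_upwards [hderiv] with h hh
    simp only [← hh]
    exact (continuous_poly s fun k => p' k h).continuousOn
  · refine (polyApprox_polyFam n s hp').congr' ?_
    refine eventually_stepFilter.2 ?_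
    filter_upwards [hderiv] with h hh t _ using hh t

variable {Ω : Set E} {y₀ : E} {σ : ℝ → ℝ → E} {σ' : ℝ × ℝ → E} {f : E → E} {T : ℝ} {y : ℝ → E}

/-- If `σ'` is the Legendre projection of `f(σ)` up to perturbations of its `j`-th coefficient of
order `2 s - j`, then the curve has order `2 s` at the end of the step. -/
theorem StepCurve.end_error_of_legendreProj [CompleteSpace E] (hσ : StepCurve Ω y₀ σ σ')
    (hΩ : IsOpen Ω)
    (hy₀ : y₀ ∈ Ω) (hf : ContDiffOn ℝ ∞ f Ω) (hT : 0 < T) (hy0 : y 0 = y₀)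
    (hy : ∀ t ∈ Set.Icc 0 T, y t ∈ Ω ∧ HasDerivWithinAt y (f (y t)) (Set.Icc 0 T) t) {s : ℕ}
    (hs : 0 < s) {D : ℕ → ℝ → E}
    (hD : ∀ j < s, D j =O[𝓝[>] 0] fun h => h ^ (2 * s - j))
    (hder : ∀ᶠ h in 𝓝[>] (0 : ℝ), ∀ c ∈ Set.Icc (0 : ℝ) 1, σ' (h, c * h) =
      legendreProj s (fun c => f (σ h (c * h))) c -
        ∑ j ∈ Finset.range s, (legendre j).eval c • D j h) :
    (fun h => σ h h - y h) =O[𝓝[>] 0] fun h => h ^ (2 * s + 1) := by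
  have hfσ : PolyApprox s fun x => f (σ x.1 x.2) := hσ.polyApprox_comp hΩ hy₀ s hf
  have hfσc := hσ.continuousOn_comp hf.continuousOn
  refine hσ.end_error_isBigO hΩ hy₀ hf hT hy0 hy hs ?_ fun z hz => ?_
  · obtain ⟨C, hC0, hC⟩ := legendreProj_sub_bound hfσ hfσc
    choose M hM0 hM using exists_legendre_bound
    have hD' : (fun h => ∑ j ∈ Finset.range s, M j * ‖D j h‖) =O[𝓝[>] 0] fun h => h ^ s :=
      IsBigO.fun_sum fun j hj => (((hD j (Finset.mem_range.mp hj)).trans (isBigO_pow_nhdsGT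
        (by have := Finset.mem_range.mp hj; lia))).norm_left.const_mul_left (M j))
    obtain ⟨C', hC'⟩ := hD'.bound
    refine isBigO_step_of_bound (C + C') ?_
    filter_upwards [hC, hC', hder, self_mem_nhdsWithin] with h hC hC' hder h0 t ht
    have h0 : 0 < h := h0
    have hc : t / h ∈ Set.Icc (0 : ℝ) 1 := ⟨div_nonneg ht.1 h0.le, (div_le_one h0).2 ht.2⟩
    have hct : t / h * h = t := div_mul_cancel₀ t h0.ne'
    have h1 := hder _ hc
    have h2 := hC _ hc
    rw [hct] at h1 h2
    rw [h1, sub_right_comm, add_mul]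
    refine (norm_sub_le _ _).trans (add_le_add h2 ?_)
    rw [Real.norm_of_nonneg (pow_nonneg h0.le s)] at hC'
    refine (norm_sum_le _ _).trans (le_trans ?_ ((le_abs_self _).trans hC'))
    refine Finset.sum_le_sum fun j _ => ?_
    rw [norm_smul]
    exact mul_le_mul_of_nonneg_right (hM j _ hc) (norm_nonneg _)
  -- The projection error drops out of the moment by orthogonality. In the rest, `D j = O(h^{2s-j})`
  -- is paired with the `j`-th Legendre coefficient of `Z`, which is `O(h^j)`.
  · have h1 : (fun h => -∑ j ∈ Finset.range s,
        legendreCoeff (fun c => polyFam s z (h, c * h)) j (D j h)) =O[𝓝[>] 0]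
        fun h => h ^ (2 * s) := by
      refine (IsBigO.fun_sum fun j hj => ?_).neg_left
      have hj := Finset.mem_range.mp hj
      have h2 := legendreCoeff_isBigO (j := j) (polyApprox_polyFam j s hz)
        (Eventually.of_forall fun h => (continuous_poly s fun k => z k h).continuousOn)
      have h3 := isBigO_bilinear (ContinuousLinearMap.id ℝ (E →L[ℝ] E)) h2 (hD j hj)
      simp only [← pow_add] at h3
      exact h3.trans (isBigO_pow_nhdsGT (by lia))
    refine h1.congr' ?_ EventuallyEq.rfl
    filter_upwards [hder, hfσc, self_mem_nhdsWithin] with h hder hfc h0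
    have h0 : 0 < h := h0
    have hu := continuousOn_comp_mul h0 hfc
    have hZc : ContinuousOn (fun c : ℝ => polyFam s z (h, c * h)) (Set.Icc 0 1) :=
      ((continuous_poly s fun k => z k h).comp (continuous_mul_const h)).continuousOn
    have hII : ∀ {F : Type} [NormedAddCommGroup F] {g : ℝ → F}, ContinuousOn g (Set.Icc 0 1) →
        IntervalIntegrable g MeasureTheory.volume 0 1 := fun hg =>
      ContinuousOn.intervalIntegrable (by rwa [Set.uIcc_of_le zero_le_one])
    have e1 : ∫ c in (0 : ℝ)..1,
          polyFam s z (h, c * h) (σ' (h, c * h) - f (σ h (c * h))) =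
        ∫ c in (0 : ℝ)..1, (polyFam s z (h, c * h)
            (legendreProj s (fun c => f (σ h (c * h))) c - f (σ h (c * h))) -
          ∑ j ∈ Finset.range s, ((legendre j).eval c • polyFam s z (h, c * h)) (D j h)) := by
      refine intervalIntegral.integral_congr fun c hc => ?_
      rw [Set.uIcc_of_le zero_le_one] at hc
      simp only [hder c hc]
      simp only [map_sub, map_sum, map_smul, smul_apply]
      abel
    rw [e1, intervalIntegral.integral_sub, intervalIntegral.integral_finsetSum]
    · have e2 : ∫ c in (0 : ℝ)..1, polyFam s z (h, c * h)
          (legendreProj s (fun c => f (σ h (c * h))) c - f (σ h (c * h))) = 0 := by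
        simp only [polyFam_mul]
        exact integral_poly_legendreProj_sub (ContinuousLinearMap.id ℝ (E →L[ℝ] E)) s
          (fun k => h ^ k • z k h) hu
      rw [e2, zero_sub]
      congr 1
      refine Finset.sum_congr rfl fun j _ => ?_
      have := (ContinuousLinearMap.apply ℝ E (D j h)).intervalIntegral_comp_comm
        (intervalIntegrable_legendre_smul hZc j)
      exact this.symm
    · intro j _
      exact hII (((legendre j).continuous.continuousOn.smul hZc).clm_apply continuousOn_const)
    · exact hII (hZc.clm_apply ((continuous_legendreProj s _).continuousOn.sub hu))
    · exact hII (continuousOn_finsetSum _ fun j _ =>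
        ((legendre j).continuous.continuousOn.smul hZc).clm_apply continuousOn_const)

end

/-- Bounded solutions of linear systems with bounded entries and determinant bounded below. -/
theorem isBigO_of_mulVec {X : Type*} {l : Filter X} {ν : ℕ} {A : X → Matrix (Fin ν) (Fin ν) ℝ}
    {x : X → Fin ν → ℝ} {φ : X → ℝ} {c : ℝ} (hc : 0 < c)
    (hA : ∀ i j, (fun h => A h i j) =O[l] fun _ => (1 : ℝ)) (hdet : ∀ᶠ h in l, c ≤ |(A h).det|)
    (hb : ∀ i, (fun h => (A h *ᵥ x h) i) =O[l] φ) (i : Fin ν) : (fun h => x h i) =O[l] φ := by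
  -- Cramer's rule in the form `adj(A) A x = det(A) x`: the cofactors are polynomials in bounded
  -- entries.
  have hadj : ∀ i j, (fun h => (A h).adjugate i j) =O[l] fun _ => (1 : ℝ) := by
    intro i j
    simp only [Matrix.adjugate_apply, Matrix.det_apply]
    refine IsBigO.fun_sum fun π _ => ?_
    have : (fun h => ∏ k, ((A h).updateRow j (Pi.single i 1)) (π k) k) =O[l]
        fun _ => ∏ _k : Fin ν, (1 : ℝ) := by
      refine IsBigO.finsetProd fun k _ => ?_
      by_cases hk : π k = j
      · simp only [Matrix.updateRow_apply, hk, if_true]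
        exact isBigO_const_const _ one_ne_zero _
      · simpa only [Matrix.updateRow_apply, hk, if_false] using hA (π k) k
    simp only [Finset.prod_const_one] at this
    rcases Int.units_eq_one_or (Equiv.Perm.sign π) with h | h <;> rw [h]
    · simpa using this
    · simpa using this
  have h1 : (fun h => ∑ j, (A h).adjugate i j * (A h *ᵥ x h) j) =O[l] φ :=
    IsBigO.fun_sum fun j _ => by simpa using (hadj i j).mul (hb j)
  refine IsBigO.trans (IsBigO.of_bound c⁻¹ ?_) h1
  filter_upwards [hdet] with h hh
  have e : ∑ j, (A h).adjugate i j * (A h *ᵥ x h) j = (A h).det * x h i := by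
    have : ((A h).adjugate *ᵥ (A h *ᵥ x h)) i = (A h).det * x h i := by
      rw [Matrix.mulVec_mulVec, Matrix.adjugate_mul, Matrix.smul_mulVec, Matrix.one_mulVec]
      rfl
    rw [← this]; rfl
  rw [e, norm_mul, ← mul_assoc, Real.norm_eq_abs (A h).det]
  refine le_mul_of_one_le_left (norm_nonneg _) ?_
  rw [inv_mul_eq_div, one_le_div hc]
  exact hh

/-! ### The method: conservation of the invariants -/

section

variable {m ν : ℕ}

theorem hamField_eq (H : Phase m → ℝ) (y : Phase m) :
    hamField H y = Matrix.toEuclideanCLM (n := Fin m ⊕ Fin m) (𝕜 := ℝ) (symJ m) (gradient H y) :=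
  rfl

theorem inner_symJ_self (x : Phase m) :
    inner ℝ x (Matrix.toEuclideanCLM (n := Fin m ⊕ Fin m) (𝕜 := ℝ) (symJ m) x) = 0 := by
  rw [Matrix.inner_toEuclideanCLM, dotProduct, Fintype.sum_sum_type]
  simp [symJ, Matrix.mulVec, dotProduct, Matrix.one_apply, mul_comm]

theorem contDiffOn_gradient {Ω : Set (Phase m)} (hΩ : IsOpen Ω) {g : Phase m → ℝ}
    (hg : ContDiffOn ℝ ∞ g Ω) : ContDiffOn ℝ ∞ (gradient g) Ω :=
  (InnerProductSpace.toDual ℝ (Phase m)).symm.contDiff.comp_contDiffOn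
    (hg.fderiv_of_isOpen hΩ (by simp))

theorem contDiffOn_hamField {Ω : Set (Phase m)} (hΩ : IsOpen Ω) {H : Phase m → ℝ}
    (hH : ContDiffOn ℝ ∞ H Ω) : ContDiffOn ℝ ∞ (hamField H) Ω :=
  (Matrix.toEuclideanCLM (n := Fin m ⊕ Fin m) (𝕜 := ℝ) (symJ m)).contDiff.comp_contDiffOn
    (contDiffOn_gradient hΩ hH)

theorem gradMatrix_transpose_mulVec (L : Phase m → Fin ν → ℝ) (y v : Phase m) (k : Fin ν) :
    ((gradMatrix L y)ᵀ *ᵥ v.ofLp) k = inner ℝ (gradient (fun z => L z k) y) v := by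
  simp only [gradMatrix, Matrix.mulVec, dotProduct, Matrix.transpose_apply, Matrix.of_apply,
    PiLp.inner_apply, RCLike.inner_apply, conj_trivial]
  exact Finset.sum_congr rfl fun i _ => mul_comm _ _

theorem phi_transpose_mulVec (L : Phase m → Fin ν → ℝ) (h : ℝ) (σ : ℝ → Phase m) (j : ℕ)
    (v : Phase m) (k : Fin ν)
    (hc : ContinuousOn (fun c => gradient (fun z => L z k) (σ (c * h))) (Set.Icc 0 1)) :
    ((phi L h σ j)ᵀ *ᵥ v.ofLp) k =
      inner ℝ (legendreCoeff (fun c => gradient (fun z => L z k) (σ (c * h))) j) v := by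
  have : ∀ i, phi L h σ j i k =
      (legendreCoeff (fun c => gradient (fun z => L z k) (σ (c * h))) j).ofLp i := by
    intro i
    have := legendreCoeff_clm hc (EuclideanSpace.proj (𝕜 := ℝ) i) j
    exact this
  simp [Matrix.mulVec, dotProduct, PiLp.inner_apply, mul_comm, this]

theorem gammaBar_eq (H : Phase m → ℝ) (h : ℝ) (σ : ℝ → Phase m) (j : ℕ) :
    gammaBar H h σ j = legendreCoeff (fun c => hamField H (σ (c * h))) j := rfl

variable {s : ℕ} {Ω : Set (Phase m)} {H : Phase m → ℝ} {L : Phase m → Fin ν → ℝ}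
  {y₀ : Phase m} {h : ℝ} {σ : ℝ → Phase m} {α : ℕ → ℝ}

theorem IsApprox.contDiff (hσ : IsApprox s Ω H L y₀ h σ α) : ContDiff ℝ 1 σ := by
  obtain ⟨p, hp⟩ := hσ.poly
  rw [show σ = _ from funext hp]
  fun_prop

theorem IsApprox.continuousOn_comp (hσ : IsApprox s Ω H L y₀ h σ α) (h0 : 0 < h)
    {F : Type} [TopologicalSpace F] {g : Phase m → F} (hg : ContinuousOn g Ω) :
    ContinuousOn (fun c => g (σ (c * h))) (Set.Icc 0 1) :=
  hg.comp (hσ.contDiff.continuous.comp (continuous_mul_const h)).continuousOn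
    fun _ hc => hσ.mem _ (mul_mem_Icc_of_mem h0 hc)

/-- The fundamental theorem of calculus for `g ∘ σ`: with `σ'` expanded in the `P_j`, integrating
`∇g` against `P_j` produces its Legendre coefficient. Both conservation laws start from this
identity. -/
theorem IsApprox.sub_eq_sum (hσ : IsApprox s Ω H L y₀ h σ α) (hΩ : IsOpen Ω) (h0 : 0 < h)
    {g : Phase m → ℝ} (hg : ContDiffOn ℝ ∞ g Ω) :
    g (σ h) - g y₀ = ∑ j ∈ Finset.range s, h * eta s ν h α j *
      inner ℝ (legendreCoeff (fun c => gradient g (σ (c * h))) j) (gammaBar H h σ j) := by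
  have hu := hσ.continuousOn_comp h0 (contDiffOn_gradient hΩ hg).continuousOn
  set u : ℝ → Phase m := fun c => gradient g (σ (c * h)) with hudef
  have hd : ∀ c ∈ Set.uIcc (0 : ℝ) 1, HasDerivAt (fun c => g (σ (c * h)))
      (∑ j ∈ Finset.range s, h * eta s ν h α j *
        innerSL ℝ (gammaBar H h σ j) ((legendre j).eval c • u c)) c := by
    intro c hc
    rw [Set.uIcc_of_le zero_le_one] at hc
    have hgd : DifferentiableAt ℝ g (σ (c * h)) := (hg.differentiableOn (by simp)).differentiableAt
      (hΩ.mem_nhds (hσ.mem _ (mul_mem_Icc_of_mem h0 hc)))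
    have h1 : HasDerivAt (fun c => σ (c * h)) (h • deriv σ (c * h)) c := by
      have := (hσ.contDiff.differentiable (by simp) (c * h)).hasDerivAt
      have h2 : HasDerivAt (fun c => c * h) h c := by simpa using (hasDerivAt_id c).mul_const h
      exact this.scomp c h2
    refine (hgd.hasFDerivAt.comp_hasDerivAt c h1).congr_deriv ?_
    rw [hσ.deriv_eq c hc, ← inner_gradient_left, inner_smul_right, inner_sum, Finset.mul_sum]
    refine Finset.sum_congr rfl fun j _ => ?_
    simp only [innerSL_apply_apply, inner_smul_right, hudef]
    rw [real_inner_comm]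
    ring
  have hi : ∀ j ∈ Finset.range s, IntervalIntegrable (fun c => h * eta s ν h α j *
        innerSL ℝ (gammaBar H h σ j) ((legendre j).eval c • u c)) MeasureTheory.volume 0 1 := by
    intro j _
    apply ContinuousOn.intervalIntegrable
    rw [Set.uIcc_of_le zero_le_one]
    exact continuousOn_const.mul ((innerSL ℝ (gammaBar H h σ j)).continuous.comp_continuousOn
      ((legendre j).continuous.continuousOn.smul hu))
  have hftc := intervalIntegral.integral_eq_sub_of_hasDerivAt hd
    (by simpa only [Finset.sum_fn] using IntervalIntegrable.sum _ hi)
  rw [one_mul, zero_mul, hσ.init] at hftc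
  rw [← hftc, intervalIntegral.integral_finsetSum hi]
  refine Finset.sum_congr rfl fun j _ => ?_
  rw [intervalIntegral.integral_const_mul, ContinuousLinearMap.intervalIntegral_comp_comm _
    (intervalIntegrable_legendre_smul hu j), innerSL_apply_apply, real_inner_comm]
  rfl

/-- `J` commutes with taking Legendre coefficients and is skew, so each term of the sum vanishes
whatever the `η_j` are. -/
theorem IsApprox.hamiltonian_eq (hσ : IsApprox s Ω H L y₀ h σ α) (hΩ : IsOpen Ω) (h0 : 0 < h)
    (hH : ContDiffOn ℝ ∞ H Ω) : H (σ h) = H y₀ := by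
  rw [← sub_eq_zero, hσ.sub_eq_sum hΩ h0 hH]
  refine Finset.sum_eq_zero fun j _ => ?_
  have hu := hσ.continuousOn_comp h0 (contDiffOn_gradient hΩ hH).continuousOn
  have := legendreCoeff_clm hu
    (Matrix.toEuclideanCLM (n := Fin m ⊕ Fin m) (𝕜 := ℝ) (symJ m)) j
  rw [gammaBar_eq]
  simp only [hamField_eq]
  rw [this, inner_symJ_self, mul_zero]

/-- Splitting the indices at `s - ν` turns the sum into `h (b - Γα)_k`; the correction parameters
are chosen to annihilate it. -/
theorem IsApprox.invariant_eq (hσ : IsApprox s Ω H L y₀ h σ α) (hνs : ν < s) (hΩ : IsOpen Ω)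
    (h0 : 0 < h) (hL : ContDiffOn ℝ ∞ L Ω) : L (σ h) = L y₀ := by
  funext k
  have hLk : ContDiffOn ℝ ∞ (fun z => L z k) Ω := contDiffOn_pi.1 hL k
  have hu := hσ.continuousOn_comp h0 (contDiffOn_gradient hΩ hLk).continuousOn
  rw [← sub_eq_zero]
  have h1 := hσ.sub_eq_sum hΩ h0 hLk
  have h2 := congrFun hσ.alpha_eq k
  simp only [← phi_transpose_mulVec L h σ _ _ k hu] at h1
  rw [h1]
  simp only [bvec, Finset.sum_apply, Matrix.mulVec, dotProduct, Gam, Matrix.of_apply] at h2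
  rw [Fin.sum_univ_eq_sum_range (fun i => h ^ (2 * (s - 1 - (s - ν + i))) *
    (∑ x, (phi L h σ (s - ν + i))ᵀ k x * (gammaBar H h σ (s - ν + i)).ofLp x) *
      α (s - ν + i)) ν] at h2
  simp only [Matrix.mulVec, dotProduct]
  have hs : s = (s - ν) + ν := by lia
  generalize hx : (fun j => ∑ x, (phi L h σ j)ᵀ k x * (gammaBar H h σ j).ofLp x) = X at *
  have hX : ∀ j, ∑ x, (phi L h σ j)ᵀ k x * (gammaBar H h σ j).ofLp x = X j := fun j => by
    rw [← hx]
  simp only [hX] at h2 ⊢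
  have e : ∑ j ∈ Finset.range s, h * eta s ν h α j * X j =
      h * (∑ j ∈ Finset.range s, X j - ∑ i ∈ Finset.range ν,
        h ^ (2 * (s - 1 - (s - ν + i))) * X (s - ν + i) * α (s - ν + i)) := by
    have hr : ∀ Y : ℕ → ℝ, ∑ j ∈ Finset.range s, Y j =
        ∑ j ∈ Finset.range (s - ν), Y j + ∑ i ∈ Finset.range ν, Y (s - ν + i) := by
      intro Y
      conv_lhs => rw [hs]
      exact Finset.sum_range_add Y _ _
    rw [hr, hr, add_sub_assoc, ← Finset.sum_sub_distrib, mul_add, Finset.mul_sum, Finset.mul_sum]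
    congr 1
    · refine Finset.sum_congr rfl fun j hj => ?_
      rw [eta, if_pos (Finset.mem_range.mp hj), mul_one]
    · refine Finset.sum_congr rfl fun i _ => ?_
      rw [eta, if_neg (by lia)]
      ring
  rw [e, h2, sub_self, mul_zero]

end

end ELIM

/-! ### The size of the correction parameters and the order of the method -/

namespace ELIM

open Filter Asymptotics

section

variable {m ν s : ℕ} {Ω : Set (Phase m)} {H : Phase m → ℝ} {L : Phase m → Fin ν → ℝ}
  {y₀ : Phase m} {σ : ℝ → ℝ → Phase m} {α : ℝ → ℕ → ℝ}

theorem stepCurve_of_isApprox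
    (hσ : ∀ᶠ h in 𝓝[>] (0 : ℝ), IsApprox s Ω H L y₀ h (σ h) (α h))
    (hT : ∀ k ≤ s, (fun h : ℝ => iteratedDeriv k (σ h) 0) =O[𝓝[>] 0] fun _ => (1 : ℝ)) :
    StepCurve Ω y₀ σ fun x => deriv (σ x.1) x.2 :=
  stepCurve_of_poly s (hσ.mono fun _ h => h.poly) (hσ.mono fun _ h => h.init)
    (hσ.mono fun _ h => h.mem) hT

theorem gammaBar_isBigO {σ' : ℝ × ℝ → Phase m} (hσ : StepCurve Ω y₀ σ σ') (hΩ : IsOpen Ω)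
    (hy₀ : y₀ ∈ Ω) (hH : ContDiffOn ℝ ∞ H Ω) (j : ℕ) :
    (fun h => gammaBar H h (σ h) j) =O[𝓝[>] 0] fun h => h ^ j :=
  legendreCoeff_isBigO (u := fun x => hamField H (σ x.1 x.2))
    (hσ.polyApprox_comp hΩ hy₀ j (contDiffOn_hamField hΩ hH))
    (hσ.continuousOn_comp (contDiffOn_hamField hΩ hH).continuousOn)

/-- The correction parameters are of order two. -/
theorem alpha_isBigO (hνs : ν < s) (hΩ : IsOpen Ω) (hH : ContDiffOn ℝ ∞ H Ω)
    (hL : ContDiffOn ℝ ∞ L Ω) (hy₀ : y₀ ∈ Ω)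
    (hinv : ∀ y ∈ Ω, (gradMatrix L y)ᵀ *ᵥ (hamField H y).ofLp = 0)
    (hσ : ∀ᶠ h in 𝓝[>] (0 : ℝ), IsApprox s Ω H L y₀ h (σ h) (α h))
    (hT : ∀ k ≤ s, (fun h : ℝ => iteratedDeriv k (σ h) 0) =O[𝓝[>] 0] fun _ => (1 : ℝ))
    {c : ℝ} (hc : 0 < c) (hdet : ∀ᶠ h in 𝓝[>] (0 : ℝ),
      c ≤ |((h ^ (2 * s - 2))⁻¹ • Gam s H L h (σ h)).det|) (i : Fin ν) :
    (fun h => α h (s - ν + (i : ℕ))) =O[𝓝[>] 0] fun h => h ^ 2 := by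
  have hcurve := stepCurve_of_isApprox hσ hT
  have hG : ∀ k, ContDiffOn ℝ ∞ (gradient fun z => L z k) Ω := fun k =>
    contDiffOn_gradient hΩ (contDiffOn_pi.1 hL k)
  have hf := contDiffOn_hamField hΩ hH
  have hφ : ∀ j k, (fun h => legendreCoeff (fun c => gradient (fun z => L z k) (σ h (c * h))) j)
      =O[𝓝[>] 0] fun h => h ^ j := fun j k =>
    legendreCoeff_isBigO (u := fun x => gradient (fun z => L z k) (σ x.1 x.2))
      (hcurve.polyApprox_comp hΩ hy₀ j (hG k)) (hcurve.continuousOn_comp (hG k).continuousOn)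
  have hphi : ∀ᶠ h in 𝓝[>] (0 : ℝ), ∀ j k,
      ((phi L h (σ h) j)ᵀ *ᵥ (gammaBar H h (σ h) j).ofLp) k =
      innerSL ℝ (legendreCoeff (fun c => gradient (fun z => L z k) (σ h (c * h))) j)
        (gammaBar H h (σ h) j) := by
    filter_upwards [hσ, self_mem_nhdsWithin] with h hσ h0 j k
    exact phi_transpose_mulVec L h (σ h) j _ k (hσ.continuousOn_comp h0 (hG k).continuousOn)
  -- Here the invariance of `L` enters: `⟨∇L_k, J∇H⟩ = 0` along the curve, so the truncated Parseval
  -- sum is of order `2s`.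
  have hb : ∀ k, (fun h => bvec s H L h (σ h) k) =O[𝓝[>] 0] fun h => h ^ (2 * s) := by
    intro k
    have h1 := sum_bilinear_legendreCoeff_isBigO (innerSL ℝ) (s := s)
      (u := fun x => gradient (fun z => L z k) (σ x.1 x.2))
      (v := fun x => hamField H (σ x.1 x.2))
      (hcurve.polyApprox_comp hΩ hy₀ s (hG k)) (hcurve.polyApprox_comp hΩ hy₀ s hf)
      (hcurve.continuousOn_comp (hG k).continuousOn) (hcurve.continuousOn_comp hf.continuousOn)
      (by
        filter_upwards [hcurve.mem] with h hm t ht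
        rw [innerSL_apply_apply, ← gradMatrix_transpose_mulVec, hinv _ (hm t ht)]
        rfl)
    refine h1.congr' ?_ EventuallyEq.rfl
    filter_upwards [hphi] with h hphi
    simp only [bvec, Finset.sum_apply, hphi]
    rfl
  have hpos : ∀ᶠ h in 𝓝[>] (0 : ℝ), h ≠ 0 := by
    filter_upwards [self_mem_nhdsWithin] with h h0 using ne_of_gt h0
  have hscale : ∀ {g : ℝ → ℝ} {n : ℕ}, g =O[𝓝[>] 0] (fun h => h ^ (2 * s - 2 + n)) →
      (fun h => (h ^ (2 * s - 2))⁻¹ * g h) =O[𝓝[>] 0] fun h => h ^ n := by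
    intro g n hg
    refine ((isBigO_refl (fun h : ℝ => (h ^ (2 * s - 2))⁻¹) (𝓝[>] 0)).mul hg).congr'
      EventuallyEq.rfl ?_
    filter_upwards [hpos] with h h0
    rw [pow_add, inv_mul_cancel_left₀ (pow_ne_zero _ h0)]
  refine isBigO_of_mulVec (A := fun h => (h ^ (2 * s - 2))⁻¹ • Gam s H L h (σ h))
    (x := fun h i => α h (s - ν + (i : ℕ))) hc (fun k i => ?_) hdet (fun k => ?_) i
  · have h1 := isBigO_bilinear (innerSL ℝ) (hφ (s - ν + i) k)
      (gammaBar_isBigO hcurve hΩ hy₀ hH (s - ν + i))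
    have h2 := (isBigO_refl (fun h : ℝ => h ^ (2 * (s - 1 - (s - ν + (i : ℕ))))) (𝓝[>] 0)).mul h1
    simp only [← pow_add] at h2
    -- The weights in `Γ` balance the columns: `2(s-1-j) + j + j = 2s - 2` for each `j`.
    rw [show 2 * (s - 1 - (s - ν + (i : ℕ))) + (s - ν + i + (s - ν + i)) = 2 * s - 2 + 0 by
      have := i.2; lia] at h2
    have h3 := hscale h2
    simp only [pow_zero] at h3
    refine h3.congr' ?_ EventuallyEq.rfl
    filter_upwards [hphi] with h hphi
    simp only [Matrix.smul_apply, Gam, Matrix.of_apply, hphi, smul_eq_mul]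
  · have h1 := hb k
    rw [show 2 * s = 2 * s - 2 + 2 by lia] at h1
    refine (hscale h1).congr' ?_ EventuallyEq.rfl
    filter_upwards [hσ] with h hσ
    simp only [Matrix.smul_mulVec, hσ.alpha_eq, Pi.smul_apply, smul_eq_mul]

end

end ELIM

theorem mainTheorem2 (m ν s : ℕ) (hνs : ν < s)
    (Ω : Set (ELIM.Phase m)) (hΩ : IsOpen Ω)
    (H : ELIM.Phase m → ℝ) (hH : ContDiffOn ℝ ∞ H Ω)
    (L : ELIM.Phase m → Fin ν → ℝ) (hL : ContDiffOn ℝ ∞ L Ω)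
    -- `L` consists of invariants: `∇L(y)ᵀ J∇H(y) = 0`
    (hinv : ∀ y ∈ Ω, (ELIM.gradMatrix L y)ᵀ *ᵥ (ELIM.hamField H y).ofLp = 0)
    (y₀ : ELIM.Phase m) (hy₀ : y₀ ∈ Ω) :
    -- conservation of all the invariants, for every step-size
    (∀ (h : ℝ) (σ : ℝ → ELIM.Phase m) (α : ℕ → ℝ), 0 < h →
      ELIM.IsApprox s Ω H L y₀ h σ α →
      H (σ h) = H y₀ ∧ L (σ h) = L y₀) ∧
    -- order of accuracy
    (∀ (T : ℝ) (y : ℝ → ELIM.Phase m), 0 < T → y 0 = y₀ →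
      (∀ t ∈ Set.Icc 0 T, y t ∈ Ω ∧
        HasDerivWithinAt y (ELIM.hamField H (y t)) (Set.Icc 0 T) t) →
      ∀ (σ : ℝ → ℝ → ELIM.Phase m) (α : ℝ → ℕ → ℝ),
        (∀ᶠ h in 𝓝[>] (0 : ℝ), ELIM.IsApprox s Ω H L y₀ h (σ h) (α h)) →
        -- the Taylor coefficients of `σ` at `0` are bounded as `h → 0`
        (∀ k ≤ s, (fun h : ℝ => iteratedDeriv k (σ h) 0) =O[𝓝[>] 0] fun _ => (1 : ℝ)) →
        -- `Γ(σ)` is nonsingular, at its scale `h^{2s-2}`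
        (∃ c : ℝ, 0 < c ∧ ∀ᶠ h in 𝓝[>] (0 : ℝ),
          c ≤ |((h ^ (2 * s - 2))⁻¹ • ELIM.Gam s H L h (σ h)).det|) →
        (fun h : ℝ => σ h h - y h) =O[𝓝[>] 0] fun h => h ^ (2 * s + 1)) := by
  refine ⟨fun h σ α h0 hσ => ⟨hσ.hamiltonian_eq hΩ h0 hH, hσ.invariant_eq hνs hΩ h0 hL⟩, ?_⟩
  rintro T y hT hy0 hy σ α hσ hTaylor ⟨c, hc, hdet⟩
  have hcurve := ELIM.stepCurve_of_isApprox hσ hTaylor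
  have hα := ELIM.alpha_isBigO hνs hΩ hH hL hy₀ hinv hσ hTaylor hc hdet
  -- The perturbation `(1 - η_j) γ̄_j` is zero for `j < s - ν`. Otherwise it is `h^{2(s-1-j)} α_j
  -- γ̄_j`, of order `2(s-1-j) + 2 + j = 2s - j`.
  refine hcurve.end_error_of_legendreProj hΩ hy₀ (ELIM.contDiffOn_hamField hΩ hH) hT hy0 hy
    (Nat.zero_lt_of_lt hνs)
    (D := fun j h => (1 - ELIM.eta s ν h (α h) j) • ELIM.gammaBar H h (σ h) j) (fun j hj => ?_) ?_
  · by_cases hjν : j < s - ν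
    · simpa [ELIM.eta, hjν] using Asymptotics.isBigO_zero (E' := ELIM.Phase m)
        (fun h : ℝ => h ^ (2 * s - j)) (𝓝[>] (0 : ℝ))
    · have h1 := hα ⟨j - (s - ν), by lia⟩
      simp only [show s - ν + (j - (s - ν)) = j by lia] at h1
      have h2 := ((Asymptotics.isBigO_refl (fun h : ℝ => h ^ (2 * (s - 1 - j))) (𝓝[>] 0)).mul
        h1).smul (ELIM.gammaBar_isBigO hcurve hΩ hy₀ hH j)
      simp only [smul_eq_mul, ← pow_add] at h2
      rw [show 2 * (s - 1 - j) + 2 + j = 2 * s - j by lia] at h2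
      simpa [ELIM.eta, hjν] using h2
  · filter_upwards [hσ] with h hσ c hc
    simp only [hσ.deriv_eq c hc, ELIM.legendreProj, ← Finset.sum_sub_distrib,
      ← ELIM.gammaBar_eq, ← smul_sub, sub_smul, one_smul, sub_sub_cancel]
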